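/- Let $n\ge 1$ be an integer, $T>0$ and $\Sigma=(0,T)\times\mathbb{R}^n$. Let $(a,b)\in[1,\infty]\times[1,\infty]$ satisfy \[ 2-\frac{2}{a}=\frac{n}{b},\qquad (n,a,b)\neq(2,\infty,1), \] and let $(q,q')$ and $(r,r')$ be the pairs of conjugate exponents determined by \[ \frac1q-\frac1{q'}=\frac1a,\qquad \frac1r-\frac1{r'}=\frac1b. \] Let $Y$ be the set of all functions $V=V^\sharp+V^\flat$ on $\Sigma$ with $V^\sharp\in L^1((0,T);L^\infty(\mathbb{R}^n))$ and with $V^\flat\in L^a((0,T);L^b(\mathbb{R}^n))$ if $a<\infty$, or $V^\flat\in C([0,T];L^{n/2}(\mathbb{R}^n))$ if $(a,b)=(\infty,n/2)$ (which forces $n\ge3$); all functions are complex valued. Let \[ X^\star=C([0,T];L^2(\mathbb{R}^n))\cap L^{q'}((0,T);L^{r'}(\mathbb{R}^n)). \] For $V\in Y$ and $h\in L^2(\mathbb{R}^n)$, a physical solution of the initial-value (respectively final-value) problem with potential $V$ and datum $h$ is a function $u\in X^\star$ with $i\partial_t u=-\Delta u+Vu$ in $\Sigma$ in the sense of distributions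 and $u(0,\cdot)=h$ (respectively $u(T,\cdot)=h$). Let $V_1,V_2\in Y$ and $f,g\in L^2(\mathbb{R}^n)$. For $j\in\{1,2\}$ let $u_j\in X^\star$ be the physical solution of the initial-value problem with potential $V_j$ and initial datum $f$, and write $\mathcal{U}_T^j f=u_j(T,\cdot)$. Let $v_2\in X^\star$ be the physical solution of the final-value problem with potential $\overline{V_2}$ and final datum $g$. Then $(V_1-V_2)\,u_1\,\overline{v_2}$ is integrable on $\Sigma$ and \[ i\int_{\mathbb{R}^n}\big(\mathcal{U}_T^1 f-\mathcal{U}_T^2 f\big)\,\overline{g}\;=\;\int_\Sigma (V_1-V_2)\,u_1\,\overline{v_2}. \] -/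

import Mathlib

open MeasureTheory Filter Topology Set
open scoped ENNReal ComplexConjugate

/-- The slab `Σ = (0, T) × ℝⁿ`. -/
def slab (n : ℕ) (T : ℝ) : Set (ℝ × EuclideanSpace ℝ (Fin n)) :=
  Ioo 0 T ×ˢ univ

/-- Membership in the mixed-norm Lebesgue space `L^p((0, T); L^s(ℝⁿ))`. -/
structure MemMixedLp {n : ℕ} (T : ℝ) (p s : ℝ≥0∞)
    (F : ℝ × EuclideanSpace ℝ (Fin n) → ℂ) : Prop where
  aestronglyMeasurable : AEStronglyMeasurable F (volume.restrict (slab n T))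
  norm_lt_top :
    eLpNorm (fun t : ℝ => eLpNorm (fun x : EuclideanSpace ℝ (Fin n) => F (t, x)) s volume) p
      (volume.restrict (Ioo 0 T)) < ∞

/-- Membership in `C([0, T]; L^s(ℝⁿ))`, for a function of `(t, x)` that is measurable on
`(0, T) × ℝⁿ` and represents at every time `t ∈ [0, T]` the value of the curve at `t`. -/
structure MemContLp {n : ℕ} (T : ℝ) (s : ℝ≥0∞)
    (F : ℝ × EuclideanSpace ℝ (Fin n) → ℂ) : Prop where
  aestronglyMeasurable : AEStronglyMeasurable F (volume.restrict (slab n T))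
  memLp : ∀ t ∈ Icc 0 T, MemLp (fun x : EuclideanSpace ℝ (Fin n) => F (t, x)) s volume
  continuous : ∀ t₀ ∈ Icc 0 T,
    Tendsto
      (fun t : ℝ => eLpNorm (fun x : EuclideanSpace ℝ (Fin n) => F (t, x) - F (t₀, x)) s volume)
      (𝓝[Icc 0 T] t₀) (𝓝 0)

/-- The condition `2 - 2 / a = n / b`, `(n, a, b) ≠ (2, ∞, 1)`, `(a, b) ∈ [1, ∞]²` on the exponents
of the potential. -/
structure PotentialExponents (n : ℕ) (a b : ℝ≥0∞) : Prop where
  one_le_left : 1 ≤ a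
  one_le_right : 1 ≤ b
  scaling : 2 / a + n / b = 2
  not_endpoint : ¬ (n = 2 ∧ a = ∞ ∧ b = 1)

/-- `q, q'` are conjugate exponents with `1 / q - 1 / q' = 1 / a`. -/
structure RelatedExponents (a q q' : ℝ≥0∞) : Prop where
  conjugate : 1 / q + 1 / q' = 1
  related : 1 / q = 1 / q' + 1 / a

/-- The potential class `Y`: sums `V♯ + V♭` with `V♯ ∈ L¹((0, T); L^∞(ℝⁿ))`, and
`V♭ ∈ L^a((0, T); L^b(ℝⁿ))` if `a < ∞`, or `V♭ ∈ C([0, T]; L^b(ℝⁿ))` if `a = ∞`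
(in which case `b = n / 2` by the relation between the exponents). -/
def MemPotentialClass {n : ℕ} (T : ℝ) (a b : ℝ≥0∞)
    (V : ℝ × EuclideanSpace ℝ (Fin n) → ℂ) : Prop :=
  ∃ Vsharp Vflat : ℝ × EuclideanSpace ℝ (Fin n) → ℂ,
    MemMixedLp T 1 ∞ Vsharp ∧
    (a ≠ ∞ → MemMixedLp T a b Vflat) ∧
    (a = ∞ → MemContLp T b Vflat) ∧
    V =ᵐ[volume.restrict (slab n T)] fun z => Vsharp z + Vflat z

/-- The space `X⋆ = C([0, T]; L²(ℝⁿ)) ∩ L^{q'}((0, T); L^{r'}(ℝⁿ))`. -/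
structure MemXStar {n : ℕ} (T : ℝ) (q' r' : ℝ≥0∞)
    (u : ℝ × EuclideanSpace ℝ (Fin n) → ℂ) : Prop where
  memContLp : MemContLp T 2 u
  memMixedLp : MemMixedLp T q' r' u

/-- The operator `-i ∂ₜ + Δ`, which is the transpose of `i ∂ₜ + Δ`, applied to a test function. -/
noncomputable def transposeSchrodinger {n : ℕ} (φ : ℝ × EuclideanSpace ℝ (Fin n) → ℂ)
    (z : ℝ × EuclideanSpace ℝ (Fin n)) : ℂ :=
  -Complex.I * deriv (fun t : ℝ => φ (t, z.2)) z.1 +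
    Laplacian.laplacian (fun x : EuclideanSpace ℝ (Fin n) => φ (z.1, x)) z.2

/-- `i ∂ₜ u = - Δ u + V u` in `Σ`, in the sense of distributions. -/
structure SolvesSchrodinger {n : ℕ} (T : ℝ) (V u : ℝ × EuclideanSpace ℝ (Fin n) → ℂ) :
    Prop where
  locallyIntegrable : LocallyIntegrableOn u (slab n T) volume
  locallyIntegrable_mul : LocallyIntegrableOn (fun z => V z * u z) (slab n T) volume
  weak : ∀ φ : ℝ × EuclideanSpace ℝ (Fin n) → ℂ,
    ContDiff ℝ (⊤ : ℕ∞) φ → HasCompactSupport φ → tsupport φ ⊆ slab n T →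
      ∫ z in slab n T, u z * transposeSchrodinger φ z = ∫ z in slab n T, V z * u z * φ z

/-- `u ∈ X⋆` is a physical solution of the Schrödinger equation with potential `V` in `Σ` which
takes the value `h` at time `τ`. The initial-value problem is the case `τ = 0` and the final-value
problem is the case `τ = T`. -/
structure IsPhysicalSolution {n : ℕ} (T : ℝ) (q' r' : ℝ≥0∞)
    (V : ℝ × EuclideanSpace ℝ (Fin n) → ℂ) (τ : ℝ)
    (h : Lp ℂ 2 (volume : Measure (EuclideanSpace ℝ (Fin n))))
    (u : ℝ × EuclideanSpace ℝ (Fin n) → ℂ) : Prop where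
  memXStar : MemXStar T q' r' u
  solves : SolvesSchrodinger T V u
  value : (fun x => u (τ, x)) =ᵐ[volume] h

/-! Put `w = conj v₂`. Formally `∂ₜu₁ = i(Δu₁ - V₁u₁)` and `∂ₜw = -i(Δw - V₂w)`. In the time
derivative of `∫ u₁ w` the Laplacians cancel by symmetry, which leaves `i [∫ u₁ w]₀ᵀ = ∫ (V₁ - V₂)
u₁ w` over the slab. The same identity for `u₂` has zero right side, because both potentials are
then `V₂`. Since `u₁` and `u₂` agree at time 0, subtracting the two identities removes the initial
terms and gives the theorem.

The solutions are too rough for this computation, so it is made after convolution in space with an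
even mollifier `ρ`. Testing the equation against `θ(t) ρ(y - x)` shows that, for every fixed `y`,
the function `t ↦ (ρ * u)(t, y)` is a primitive of an integrable function
(`SolvesSchrodinger.spatialEvolution`). The product rule for absolutely continuous functions and
Fubini then give the mollified identity (`integral_mollified_product`).

The mollifier is handled through the correlation function `C(h) = ∫ f(t, x + h) g(t, x)`. The
integral of `(ρ * f)(σ * g)` is the average of `C(q - p)` against `ρ(p) σ(q)`. For even `ρ`, `σ`
this is symmetric in `ρ` and `σ`, so the `Δρ` terms cancel without any derivative falling on `u`.
Continuity of `C` at 0 gives the limit as the mollifier shrinks.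

The hypotheses on correlations come from Hölder: conjugacy and `1/q = 1/q' + 1/a` give `1/a + 2/q' =
1`, and likewise `1/b + 2/r' = 1`, so `V♭ u w` is integrable when `u, w ∈ L^{q'}L^{r'}`. The part
`V♯ ∈ L¹L^∞` is paired with `u, w ∈ L^∞L²`. -/

/-! ### Absolutely continuous functions and weak derivatives on an interval. -/

theorem absolutelyContinuousOnInterval_ofReal {f : ℝ → ℝ} {a b : ℝ}
    (hf : AbsolutelyContinuousOnInterval f a b) (c : ℂ) :
    AbsolutelyContinuousOnInterval (fun t => f t • c) a b := by
  have hc : AbsolutelyContinuousOnInterval (fun _ : ℝ => c) a b :=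
    (contDiff_const.contDiffOn (s := uIcc a b)).absolutelyContinuousOnInterval
  exact hf.fun_smul hc

theorem IntervalIntegrable.absolutelyContinuousOnInterval_complex {w : ℝ → ℂ} {a b : ℝ}
    (hw : IntervalIntegrable w volume a b) :
    AbsolutelyContinuousOnInterval (fun t => ∫ s in a..t, w s) a b := by
  have hre : IntervalIntegrable (fun s => (w s).re) volume a b := ⟨hw.1.re, hw.2.re⟩
  have him : IntervalIntegrable (fun s => (w s).im) volume a b := ⟨hw.1.im, hw.2.im⟩
  have h1 := absolutelyContinuousOnInterval_ofReal
    (hre.absolutelyContinuousOnInterval_intervalIntegral (c := a) (by simp)) 1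
  have h2 := absolutelyContinuousOnInterval_ofReal
    (him.absolutelyContinuousOnInterval_intervalIntegral (c := a) (by simp)) Complex.I
  have h3 := h1.fun_add h2
  rw [absolutelyContinuousOnInterval_iff] at h3 ⊢
  have key : ∀ t ∈ uIcc a b, ∫ s in a..t, w s =
      (∫ s in a..t, (w s).re) • (1 : ℂ) + (∫ s in a..t, (w s).im) • Complex.I := by
    intro t ht
    have hsub : uIcc a t ⊆ uIcc a b := uIcc_subset_uIcc_left ht
    have e1 : (((∫ s in a..t, (w s).re : ℝ)) : ℂ) = ∫ s in a..t, ((w s).re : ℂ) :=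
      (intervalIntegral.integral_ofReal).symm
    have e2 : (((∫ s in a..t, (w s).im : ℝ)) : ℂ) = ∫ s in a..t, ((w s).im : ℂ) :=
      (intervalIntegral.integral_ofReal).symm
    simp only [Complex.real_smul, mul_one]
    rw [e1, e2, ← intervalIntegral.integral_mul_const, ← intervalIntegral.integral_add]
    · simp [Complex.re_add_im]
    · exact ⟨(hre.mono_set hsub).1.ofReal, (hre.mono_set hsub).2.ofReal⟩
    · exact IntervalIntegrable.mul_const
        ⟨(him.mono_set hsub).1.ofReal, (him.mono_set hsub).2.ofReal⟩ _
  intro ε hε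
  obtain ⟨δ, hδ, H⟩ := h3 ε hε
  refine ⟨δ, hδ, fun E hE hlt => ?_⟩
  convert H E hE hlt using 2 with i hi
  rw [key _ (hE.1 i hi).1, key _ (hE.1 i hi).2]

/-- Integration by parts with merely integrable derivatives: `M N` minus the primitive of `w₁ N + M
w₂` is absolutely continuous with zero derivative almost everywhere, hence constant. -/
theorem integral_primitive_mul_primitive {a b : ℝ} {M N w₁ w₂ : ℝ → ℂ}
    (hw₁ : IntervalIntegrable w₁ volume a b) (hw₂ : IntervalIntegrable w₂ volume a b)
    (hM : ∀ t ∈ uIcc a b, M t = M a + ∫ s in a..t, w₁ s)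
    (hN : ∀ t ∈ uIcc a b, N t = N a + ∫ s in a..t, w₂ s) :
    IntervalIntegrable (fun t => w₁ t * N t + M t * w₂ t) volume a b ∧
    ∫ t in a..b, (w₁ t * N t + M t * w₂ t) = M b * N b - M a * N a := by
  have hc : ∀ c : ℂ, AbsolutelyContinuousOnInterval (fun _ : ℝ => c) a b := fun c =>
    (contDiff_const.contDiffOn (s := uIcc a b)).absolutelyContinuousOnInterval
  have hM' := (hc (M a)).fun_add hw₁.absolutelyContinuousOnInterval_complex
  have hN' := (hc (N a)).fun_add hw₂.absolutelyContinuousOnInterval_complex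
  have hMc : ContinuousOn M (uIcc a b) := hM'.continuousOn.congr hM
  have hNc : ContinuousOn N (uIcc a b) := hN'.continuousOn.congr hN
  have hint : IntervalIntegrable (fun t => w₁ t * N t + M t * w₂ t) volume a b :=
    (hw₁.mul_continuousOn hNc).add (hw₂.continuousOn_mul hMc)
  refine ⟨hint, ?_⟩
  have hac := (hM'.fun_smul hN').fun_sub hint.absolutelyContinuousOnInterval_complex
  obtain ⟨C, hC⟩ := hac.const_of_ae_hasDerivAt_zero (by
    filter_upwards [hw₁.ae_hasDerivAt_integral, hw₂.ae_hasDerivAt_integral,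
      hint.ae_hasDerivAt_integral] with x h1 h2 h3 hx
    have d1 := (h1 hx a (by simp)).const_add (M a)
    have d2 := (h2 hx a (by simp)).const_add (N a)
    have d3 := (d1.mul d2).sub (h3 hx a (by simp))
    refine d3.congr_deriv ?_
    rw [← hM x hx, ← hN x hx]
    ring)
  have ha := hC a (by simp)
  have hb := hC b (by simp)
  simp only [smul_eq_mul] at ha hb
  rw [← hM b (by simp), ← hN b (by simp), ← ha] at hb
  simp only [intervalIntegral.integral_same, add_zero, sub_zero] at hb
  linear_combination -hb

theorem IsCompact.exists_Icc_subset_Ioo {K : Set ℝ} (hK : IsCompact K) (hne : K.Nonempty) {a b : ℝ}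
    (h : K ⊆ Ioo a b) : ∃ α β, a < α ∧ α ≤ β ∧ β < b ∧ K ⊆ Icc α β := by
  obtain ⟨α, hα, hα'⟩ := hK.exists_isLeast hne
  obtain ⟨β, hβ, hβ'⟩ := hK.exists_isGreatest hne
  exact ⟨α, β, (h hα).1, hα' hβ, (h hβ).2, fun x hx => ⟨hα' hx, hβ' hx⟩⟩

/-- The primitive that starts at the left end of the support vanishes to the left trivially, and to
the right because the total integral is zero. -/
theorem exists_primitive_of_integral_eq_zero {T : ℝ} {η : ℝ → ℝ} (hη : ContDiff ℝ (⊤ : ℕ∞) η)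
    {K : Set ℝ} (hK : IsCompact K) (hKT : K ⊆ Ioo 0 T) (hne : K.Nonempty) (hsupp : ∀ t ∉ K, η t = 0)
    (hint : ∫ t, η t = 0) :
    ∃ θ : ℝ → ℝ, ContDiff ℝ (⊤ : ℕ∞) θ ∧ HasCompactSupport θ ∧ tsupport θ ⊆ Ioo 0 T ∧
      deriv θ = η := by
  obtain ⟨α, β, hα, hαβ, hβ, hKs⟩ := hK.exists_Icc_subset_Ioo hne hKT
  have hd : ∀ t, HasDerivAt (fun t => ∫ s in α..t, η s) (η t) t := fun t =>
    intervalIntegral.integral_hasDerivAt_right (hη.continuous.intervalIntegrable _ _)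
      (hη.continuous.stronglyMeasurableAtFilter _ _) hη.continuous.continuousAt
  have hderiv : deriv (fun t => ∫ s in α..t, η s) = η := funext fun t => (hd t).deriv
  have hz : ∀ t ∉ Icc α β, ∫ s in α..t, η s = 0 := by
    intro t ht
    rcases lt_or_ge t α with h | h
    · rw [intervalIntegral.integral_symm, intervalIntegral.integral_of_le h.le,
        setIntegral_eq_zero_of_ae_eq_zero, neg_zero]
      have : ∀ᵐ s : ℝ, s ≠ α := by simp [ae_iff]
      filter_upwards [this] with s hs hs'
      exact hsupp s fun hsK => hs (le_antisymm hs'.2 (hKs hsK).1)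
    · have hβt : β < t := by
        by_contra hcon
        exact ht ⟨h, not_lt.1 hcon⟩
      rw [intervalIntegral.integral_of_le h, ← hint]
      refine setIntegral_eq_integral_of_ae_compl_eq_zero ?_
      have : ∀ᵐ s : ℝ, s ≠ α := by simp [ae_iff]
      filter_upwards [this] with s hs hs'
      refine hsupp s fun hsK => hs' ⟨lt_of_le_of_ne (hKs hsK).1 hs.symm, (hKs hsK).2.trans hβt.le⟩
  have hts : tsupport (fun t => ∫ s in α..t, η s) ⊆ Icc α β :=
    closure_minimal (fun t ht => by_contra fun hc => ht (hz t hc)) isClosed_Icc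
  refine ⟨fun t => ∫ s in α..t, η s, ?_, ?_, ?_, hderiv⟩
  · rw [contDiff_infty_iff_deriv, hderiv]
    exact ⟨fun t => (hd t).differentiableAt, hη⟩
  · exact isCompact_Icc.of_isClosed_subset (isClosed_tsupport _) hts
  · exact hts.trans fun t ht => ⟨hα.trans_le ht.1, ht.2.trans_lt hβ⟩

/-- The du Bois-Reymond lemma. Subtracting from a test function `ζ` the multiple `(∫ ζ) χ` of a
fixed normalised bump gives mean zero, hence the derivative of a test function. So `k - c` is
orthogonal to every `ζ`, with `c = ∫ χ k`. -/
theorem eqOn_const_of_integral_deriv_mul_eq_zero {T : ℝ} (hT : 0 < T) {k : ℝ → ℂ}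
    (hk : ContinuousOn k (Icc 0 T))
    (h : ∀ θ : ℝ → ℝ, ContDiff ℝ (⊤ : ℕ∞) θ → HasCompactSupport θ → tsupport θ ⊆ Ioo 0 T →
      ∫ t in Ioo 0 T, ((deriv θ t : ℝ) : ℂ) * k t = 0) :
    ∀ t ∈ Icc 0 T, k t = k 0 := by
  -- The outer radius keeps the support inside `[T/4, 3T/4]`.
  let χ : ContDiffBump (T / 2) := ⟨T / 8, T / 4, by positivity, by linarith⟩
  have hχts : tsupport (χ.normed volume) ⊆ Ioo 0 T := by
    rw [χ.tsupport_normed_eq]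
    intro t ht
    rw [Real.closedBall_eq_Icc] at ht
    have h1 := ht.1
    have h2 := ht.2
    simp only [χ] at h1 h2
    constructor <;> linarith
  have hkI : IntegrableOn k (Ioo 0 T) :=
    (hk.integrableOn_Icc).mono_set Ioo_subset_Icc_self
  have hmul : ∀ ζ : ℝ → ℝ, ContDiff ℝ (⊤ : ℕ∞) ζ → HasCompactSupport ζ →
      IntegrableOn (fun t => (ζ t : ℂ) * k t) (Ioo 0 T) := by
    intro ζ hζ hζc
    obtain ⟨C, hC⟩ := hζ.continuous.bounded_above_of_compact_support hζc
    refine hkI.bdd_mul (c := C) ?_ ?_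
    · exact (Complex.continuous_ofReal.comp hζ.continuous).aestronglyMeasurable
    · exact ae_of_all _ fun t => by simpa using hC t
  set c : ℂ := ∫ t in Ioo 0 T, (χ.normed volume t : ℂ) * k t with hc
  have hae : ∀ᵐ t, t ∈ Ioo 0 T → k t - c = 0 := by
    refine isOpen_Ioo.ae_eq_zero_of_integral_contDiff_smul_eq_zero ?_ ?_
    · exact (hkI.sub (integrableOn_const (by simp))).locallyIntegrableOn
    · intro ζ hζ hζc hζs
      set d : ℝ := ∫ t, ζ t with hd
      have hη : ContDiff ℝ (⊤ : ℕ∞) (fun t => ζ t - d * χ.normed volume t) :=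
        hζ.sub (contDiff_const.mul χ.contDiff_normed)
      have hζI : Integrable ζ := hζ.continuous.integrable_of_hasCompactSupport hζc
      obtain ⟨θ, h1, h2, h3, h4⟩ := exists_primitive_of_integral_eq_zero (T := T) hη
        (K := tsupport ζ ∪ tsupport (χ.normed volume)) (hζc.union χ.hasCompactSupport_normed)
        (union_subset hζs hχts)
        (by rw [χ.tsupport_normed_eq]; exact ⟨T / 2, Or.inr (by simp [χ.rOut_pos.le])⟩)
        (fun t ht => by
          simp only [mem_union, not_or] at ht
          rw [image_eq_zero_of_notMem_tsupport ht.1, image_eq_zero_of_notMem_tsupport ht.2]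
          simp)
        (by
          rw [integral_sub hζI (χ.integrable_normed.const_mul d), integral_const_mul,
            χ.integral_normed, mul_one, sub_self])
      have h5 := h θ h1 h2 h3
      rw [h4] at h5
      have h6 : ∫ t in Ioo 0 T, ((ζ t : ℂ) * k t - d * ((χ.normed volume t : ℂ) * k t)) = 0 := by
        rw [← h5]; congr 1; ext t; push_cast; ring
      rw [integral_sub (hmul ζ hζ hζc)
        ((hmul _ χ.contDiff_normed χ.hasCompactSupport_normed).const_mul _),
        integral_const_mul, ← hc] at h6
      have h7 : ∫ t, ζ t • (k t - c) = ∫ t in Ioo 0 T, ζ t • (k t - c) := by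
        refine (setIntegral_eq_integral_of_forall_compl_eq_zero fun t ht => ?_).symm
        rw [image_eq_zero_of_notMem_tsupport fun hh => ht (hζs hh), zero_smul]
      have h8 : ∫ t in Ioo 0 T, (ζ t : ℂ) = d := by
        rw [setIntegral_eq_integral_of_forall_compl_eq_zero fun t ht => ?_]
        · exact integral_ofReal
        rw [image_eq_zero_of_notMem_tsupport fun hh => ht (hζs hh), Complex.ofReal_zero]
      rw [h7]
      have hζc' : IntegrableOn (fun t => (ζ t : ℂ) * c) (Ioo 0 T) :=
        (hζI.ofReal.mul_const c).integrableOn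
      have h9 : ∫ t in Ioo 0 T, ζ t • (k t - c)
          = ∫ t in Ioo 0 T, ((ζ t : ℂ) * k t - (ζ t : ℂ) * c) := by
        congr 1; ext t; rw [Complex.real_smul]; ring
      rw [h9, integral_sub (hmul ζ hζ hζc) hζc',
        integral_mul_const, h8]
      exact h6
  -- Continuity upgrades equality almost everywhere to equality everywhere, endpoints included.
  have heq : EqOn k (fun _ => c) (Icc 0 T) := by
    have hae' : k =ᵐ[volume.restrict (Icc 0 T)] fun _ => c := by
      rw [← restrict_Ioo_eq_restrict_Icc]
      refine (ae_restrict_iff' measurableSet_Ioo).2 ?_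
      filter_upwards [hae] with t ht ht'
      exact sub_eq_zero.1 (ht ht')
    exact Measure.eqOn_Icc_of_ae_eq volume hT.ne hae' hk continuousOn_const
  intro t ht
  rw [heq ht, heq ⟨le_rfl, hT.le⟩]

/-- By parts, `m` minus the primitive of `w` has zero weak derivative, and the previous lemma makes
it constant. -/
theorem eq_add_integral_of_weak_deriv {T : ℝ} (hT : 0 < T) {m w : ℝ → ℂ}
    (hm : ContinuousOn m (Icc 0 T)) (hw : IntervalIntegrable w volume 0 T)
    (h : ∀ θ : ℝ → ℝ, ContDiff ℝ (⊤ : ℕ∞) θ → HasCompactSupport θ → tsupport θ ⊆ Ioo 0 T →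
      ∫ t in Ioo 0 T, ((deriv θ t : ℝ) : ℂ) * m t = - ∫ t in Ioo 0 T, (θ t : ℂ) * w t) :
    ∀ t ∈ Icc 0 T, m t = m 0 + ∫ s in 0..t, w s := by
  have hWc : ContinuousOn (fun t => ∫ s in 0..t, w s) (Icc 0 T) := by
    have := hw.absolutelyContinuousOnInterval_complex.continuousOn
    rwa [uIcc_of_le hT.le] at this
  have key := eqOn_const_of_integral_deriv_mul_eq_zero hT (hm.sub hWc) (fun θ h1 h2 h3 => by
    have hθ' : Continuous (deriv θ) := h1.continuous_deriv (by simp)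
    have hθ0 : ∀ t ∉ Ioo 0 T, θ t = 0 := fun t ht =>
      image_eq_zero_of_notMem_tsupport fun hh => ht (h3 hh)
    have hprim : ∀ t ∈ uIcc 0 T, (θ t : ℂ) = (θ 0 : ℂ) + ∫ s in 0..t, ((deriv θ s : ℝ) : ℂ) := by
      intro t _
      rw [intervalIntegral.integral_ofReal, intervalIntegral.integral_deriv_eq_sub'
        _ rfl (fun x _ => (h1.differentiable (by simp)).differentiableAt) hθ'.continuousOn]
      push_cast; ring
    have hθi : IntervalIntegrable (fun s => ((deriv θ s : ℝ) : ℂ)) volume 0 T :=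
      (Complex.continuous_ofReal.comp hθ').intervalIntegrable _ _
    have hWi : ∀ t ∈ uIcc 0 T, (∫ s in 0..t, w s) = (∫ s in (0:ℝ)..0, w s) + ∫ s in 0..t, w s := by
      simp
    have h4 := (integral_primitive_mul_primitive hθi hw hprim hWi).2
    rw [hθ0 0 (by simp), hθ0 T (by simp)] at h4
    simp only [Complex.ofReal_zero, zero_mul, sub_zero] at h4
    have hθW : IntervalIntegrable (fun t => ((deriv θ t : ℝ) : ℂ) * ∫ s in 0..t, w s) volume 0 T :=
      hθi.mul_continuousOn (by rwa [uIcc_of_le hT.le])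
    have hθw : IntervalIntegrable (fun t => (θ t : ℂ) * w t) volume 0 T :=
      hw.continuousOn_mul (Complex.continuous_ofReal.comp h1.continuous).continuousOn
    have hθm : IntervalIntegrable (fun t => ((deriv θ t : ℝ) : ℂ) * m t) volume 0 T :=
      hθi.mul_continuousOn (by rwa [uIcc_of_le hT.le])
    rw [intervalIntegral.integral_add hθW hθw] at h4
    have h5 := h θ h1 h2 h3
    rw [← integral_Ioc_eq_integral_Ioo, ← integral_Ioc_eq_integral_Ioo,
      ← intervalIntegral.integral_of_le hT.le, ← intervalIntegral.integral_of_le hT.le] at h5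
    rw [← integral_Ioc_eq_integral_Ioo, ← intervalIntegral.integral_of_le hT.le]
    have h6 : ∫ t in 0..T, ((deriv θ t : ℝ) : ℂ) * (m t - ∫ s in 0..t, w s)
        = (∫ t in 0..T, ((deriv θ t : ℝ) : ℂ) * m t) -
          ∫ t in 0..T, ((deriv θ t : ℝ) : ℂ) * ∫ s in 0..t, w s := by
      rw [← intervalIntegral.integral_sub hθm hθW]
      congr 1; ext t; ring
    simp only [Pi.sub_apply]
    rw [h6, h5]
    linear_combination -h4)
  intro t ht
  have := key t ht
  simp only [Pi.sub_apply, intervalIntegral.integral_same, sub_zero] at this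
  linear_combination this

/-! ### Mixed norms on the slab. -/

/-- Lebesgue measure on `(0, T) × ℝⁿ` as a product measure. -/
noncomputable abbrev slabMeasure (n : ℕ) (T : ℝ) : Measure (ℝ × EuclideanSpace ℝ (Fin n)) :=
  (volume.restrict (Ioo 0 T)).prod volume

theorem volume_restrict_slab (n : ℕ) (T : ℝ) :
    (volume : Measure (ℝ × EuclideanSpace ℝ (Fin n))).restrict (slab n T) = slabMeasure n T := by
  rw [slab, Measure.volume_eq_prod, ← Measure.prod_restrict, Measure.restrict_univ]

theorem measurable_eLpNorm_slice {α β : Type*} [MeasurableSpace α] [MeasurableSpace β]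
    {ν : Measure β} [SFinite ν] {F : α × β → ℂ} (hF : StronglyMeasurable F) (s : ℝ≥0∞) :
    Measurable fun a => eLpNorm (fun b => F (a, b)) s ν := by
  rcases eq_or_ne s 0 with rfl | h0
  · simp
  rcases eq_or_ne s ∞ with rfl | htop
  -- An essential supremum is at most `c` exactly when the slice of `{c < ‖F‖}` is null, and the
  -- measure of a slice is measurable in `a`.
  · refine measurable_of_Iic fun c => ?_
    have : (fun a => eLpNorm (fun b => F (a, b)) ∞ ν) ⁻¹' Iic c
        = (fun a => ν (Prod.mk a ⁻¹' {z : α × β | c < ‖F z‖ₑ})) ⁻¹' {0} := by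
      ext a
      simp only [eLpNorm_exponent_top, mem_preimage, mem_Iic, mem_singleton_iff]
      constructor
      · intro h
        have := enorm_ae_le_eLpNormEssSup (fun b => F (a, b)) ν
        refine measure_mono_null ?_ (ae_iff.1 this)
        intro b hb
        simp only [preimage_ofPred_eq, mem_ofPred_eq, not_le] at hb ⊢
        exact h.trans_lt hb
      · intro h
        refine essSup_le_of_ae_le _ ?_
        rw [EventuallyLE, ae_iff]
        simpa using h
    rw [this]
    exact measurable_measure_prodMk_left (measurableSet_lt measurable_const hF.enorm)
      (measurableSet_singleton 0)
  · simp_rw [eLpNorm_eq_lintegral_rpow_enorm_toReal h0 htop]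
    exact (Measurable.lintegral_prod_right' (hF.enorm.pow_const s.toReal)).pow_const _

theorem aemeasurable_eLpNorm_slice {α β : Type*} [MeasurableSpace α] [MeasurableSpace β]
    {κ : Measure α} {ν : Measure β} [SFinite ν] {F : α × β → ℂ}
    (hF : AEStronglyMeasurable F (κ.prod ν)) (s : ℝ≥0∞) :
    AEMeasurable (fun a => eLpNorm (fun b => F (a, b)) s ν) κ := by
  refine ⟨_, measurable_eLpNorm_slice (ν := ν) hF.stronglyMeasurable_mk s, ?_⟩
  filter_upwards [Measure.ae_ae_of_ae_prod hF.ae_eq_mk] with a ha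
  exact eLpNorm_congr_ae ha

theorem ae_lt_top_of_eLpNorm_lt_top {α : Type*} [MeasurableSpace α] {κ : Measure α} {f : α → ℝ≥0∞}
    (hf : AEMeasurable f κ) {p : ℝ≥0∞} (hp : p ≠ 0) (h : eLpNorm f p κ < ∞) :
    ∀ᵐ a ∂κ, f a < ∞ := by
  rcases eq_or_ne p ∞ with rfl | htop
  · rw [eLpNorm_exponent_top] at h
    filter_upwards [enorm_ae_le_eLpNormEssSup f κ] with a ha
    exact lt_of_le_of_lt ha h
  · rw [eLpNorm_lt_top_iff_lintegral_rpow_enorm_lt_top hp htop] at h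
    filter_upwards [ae_lt_top' (hf.pow_const p.toReal) h.ne] with a ha
    by_contra hcon
    rw [not_lt, top_le_iff] at hcon
    rw [hcon, ENNReal.top_rpow_of_pos (ENNReal.toReal_pos hp htop)] at ha
    exact lt_irrefl _ ha

theorem memLp_toReal_of_eLpNorm_lt_top {α : Type*} [MeasurableSpace α] {κ : Measure α}
    {f : α → ℝ≥0∞} (hf : AEMeasurable f κ) {p : ℝ≥0∞} (hp : p ≠ 0) (h : eLpNorm f p κ < ∞) :
    MemLp (fun a => (f a).toReal) p κ := by
  refine ⟨hf.ennreal_toReal.aestronglyMeasurable, lt_of_le_of_lt (le_of_eq ?_) h⟩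
  refine eLpNorm_congr_enorm_ae ?_
  filter_upwards [ae_lt_top_of_eLpNorm_lt_top hf hp h] with a ha
  rw [Real.enorm_of_nonneg ENNReal.toReal_nonneg, ENNReal.ofReal_toReal ha.ne]
  rfl

/-- Three-factor Hölder in time. The factors are slice norms with values in `[0, ∞]`; they are
finite almost everywhere, which allows the passage to real-valued functions. -/
theorem lintegral_mul_mul_lt_top {α : Type*} [MeasurableSpace α] {κ : Measure α}
    {f₁ f₂ f₃ : α → ℝ≥0∞} {p₁ p₂ p₃ : ℝ≥0∞} (hp : p₁⁻¹ + p₂⁻¹ + p₃⁻¹ = 1)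
    (hf₁ : AEMeasurable f₁ κ) (hf₂ : AEMeasurable f₂ κ) (hf₃ : AEMeasurable f₃ κ)
    (h₁ : eLpNorm f₁ p₁ κ < ∞) (h₂ : eLpNorm f₂ p₂ κ < ∞) (h₃ : eLpNorm f₃ p₃ κ < ∞) :
    ∫⁻ a, f₁ a * f₂ a * f₃ a ∂κ ≠ ∞ := by
  have n₁ : p₁ ≠ 0 := by rintro rfl; simp at hp
  have n₂ : p₂ ≠ 0 := by rintro rfl; simp at hp
  have n₃ : p₃ ≠ 0 := by rintro rfl; simp at hp
  have : ENNReal.HolderTriple p₁ p₂ (p₁⁻¹ + p₂⁻¹)⁻¹ := ⟨by simp⟩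
  have : ENNReal.HolderTriple (p₁⁻¹ + p₂⁻¹)⁻¹ p₃ 1 := ⟨by simp [hp]⟩
  have m : MemLp (fun a => (f₁ a).toReal * (f₂ a).toReal * (f₃ a).toReal) 1 κ :=
    MemLp.mul' (p := (p₁⁻¹ + p₂⁻¹)⁻¹) (q := p₃) (memLp_toReal_of_eLpNorm_lt_top hf₃ n₃ h₃)
      (MemLp.mul' (p := p₁) (q := p₂) (memLp_toReal_of_eLpNorm_lt_top hf₂ n₂ h₂)
        (memLp_toReal_of_eLpNorm_lt_top hf₁ n₁ h₁))
  have m' := m.2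
  rw [eLpNorm_one_eq_lintegral_enorm] at m'
  refine ((lintegral_congr_ae ?_).trans_lt m').ne
  filter_upwards [ae_lt_top_of_eLpNorm_lt_top hf₁ n₁ h₁, ae_lt_top_of_eLpNorm_lt_top hf₂ n₂ h₂,
    ae_lt_top_of_eLpNorm_lt_top hf₃ n₃ h₃] with a a₁ a₂ a₃
  rw [Real.enorm_of_nonneg (by positivity), ENNReal.ofReal_mul (by positivity),
    ENNReal.ofReal_mul (by positivity), ENNReal.ofReal_toReal a₁.ne, ENNReal.ofReal_toReal a₂.ne,
    ENNReal.ofReal_toReal a₃.ne]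

section

variable {n : ℕ} {T : ℝ}

theorem MemMixedLp.aestronglyMeasurable' {p s : ℝ≥0∞} {F : ℝ × EuclideanSpace ℝ (Fin n) → ℂ}
    (hF : MemMixedLp T p s F) : AEStronglyMeasurable F (slabMeasure n T) := by
  rw [← volume_restrict_slab]; exact hF.aestronglyMeasurable

theorem MemMixedLp.ae_memLp {p s : ℝ≥0∞} {F : ℝ × EuclideanSpace ℝ (Fin n) → ℂ}
    (hF : MemMixedLp T p s F) (hp : p ≠ 0) :
    ∀ᵐ t ∂(volume.restrict (Ioo 0 T)), MemLp (fun x => F (t, x)) s volume := by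
  filter_upwards [ae_lt_top_of_eLpNorm_lt_top
    (aemeasurable_eLpNorm_slice hF.aestronglyMeasurable' s) hp hF.norm_lt_top,
    hF.aestronglyMeasurable'.prodMk_left] with t h1 h2
  exact ⟨h2, h1⟩

/-- Continuity bounds the norm near each time, and compactness of `[0, T]` makes the bound global.
-/
theorem MemContLp.exists_eLpNorm_le {s : ℝ≥0∞} (hs : 1 ≤ s)
    {F : ℝ × EuclideanSpace ℝ (Fin n) → ℂ} (hF : MemContLp T s F) :
    ∃ C : ℝ≥0∞, C ≠ ∞ ∧ ∀ t ∈ Icc 0 T, eLpNorm (fun x => F (t, x)) s volume ≤ C := by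
  refine isCompact_Icc.induction_on (p := fun S => ∃ C : ℝ≥0∞, C ≠ ∞ ∧ ∀ t ∈ S,
    eLpNorm (fun x => F (t, x)) s volume ≤ C) ⟨0, by simp⟩ ?_ ?_ ?_
  · rintro S S' hSS' ⟨C, hC, h⟩
    exact ⟨C, hC, fun t ht => h t (hSS' ht)⟩
  · rintro S S' ⟨C, hC, h⟩ ⟨C', hC', h'⟩
    refine ⟨max C C', by simp [hC, hC'], fun t ht => ?_⟩
    rcases ht with ht | ht
    · exact (h t ht).trans (le_max_left _ _)
    · exact (h' t ht).trans (le_max_right _ _)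
  · intro t₀ ht₀
    refine ⟨{t | t ∈ Icc 0 T ∧
      eLpNorm (fun x => F (t, x) - F (t₀, x)) s volume < 1}, ?_,
      1 + eLpNorm (fun x => F (t₀, x)) s volume,
      ENNReal.add_ne_top.2 ⟨by simp, (hF.memLp t₀ ht₀).2.ne⟩, ?_⟩
    · exact eventually_mem_nhdsWithin.and
        ((hF.continuous t₀ ht₀).eventually (gt_mem_nhds one_pos))
    · rintro t ⟨ht, hlt⟩
      have h1 := eLpNorm_add_le (((hF.memLp t ht).1).sub (hF.memLp t₀ ht₀).1)
        (hF.memLp t₀ ht₀).1 hs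
      have h2 : (fun x => F (t, x)) =
          ((fun x => F (t, x)) - fun x => F (t₀, x)) + fun x => F (t₀, x) := by simp
      rw [h2]
      exact h1.trans (add_le_add_left hlt.le _)

theorem MemContLp.memMixedLp {s : ℝ≥0∞} (hs : 1 ≤ s)
    {F : ℝ × EuclideanSpace ℝ (Fin n) → ℂ} (hF : MemContLp T s F) : MemMixedLp T ∞ s F := by
  obtain ⟨C, hC, h⟩ := hF.exists_eLpNorm_le hs
  refine ⟨hF.aestronglyMeasurable, lt_of_le_of_lt ?_ (lt_top_iff_ne_top.2 hC)⟩
  rw [eLpNorm_exponent_top]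
  refine essSup_le_of_ae_le _ ?_
  refine (ae_restrict_iff' measurableSet_Ioo).2 (ae_of_all _ fun t ht => ?_)
  exact h t (Ioo_subset_Icc_self ht)

theorem MeasureTheory.MemLp.memMixedLp_snd {s : ℝ≥0∞} {g : EuclideanSpace ℝ (Fin n) → ℂ}
    (hg : MemLp g s volume) (p : ℝ≥0∞) : MemMixedLp T p s (fun z => g z.2) := by
  refine ⟨?_, ?_⟩
  · rw [volume_restrict_slab]
    exact hg.1.comp_quasiMeasurePreserving Measure.quasiMeasurePreserving_snd
  · have : MemLp (fun _ : ℝ => (eLpNorm g s volume).toReal) p (volume.restrict (Ioo 0 T)) :=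
      memLp_const _
    refine lt_of_le_of_lt (le_of_eq (eLpNorm_congr_enorm_ae (ae_of_all _ fun t => ?_))) this.2
    rw [Real.enorm_of_nonneg ENNReal.toReal_nonneg, ENNReal.ofReal_toReal hg.2.ne]
    rfl

theorem MemMixedLp.conj {p s : ℝ≥0∞} {F : ℝ × EuclideanSpace ℝ (Fin n) → ℂ}
    (hF : MemMixedLp T p s F) : MemMixedLp T p s (fun z => conj (F z)) := by
  refine ⟨Complex.continuous_conj.comp_aestronglyMeasurable hF.aestronglyMeasurable, ?_⟩
  refine lt_of_le_of_lt (le_of_eq ?_) hF.norm_lt_top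
  congr 1
  ext t
  exact eLpNorm_congr_norm_ae (ae_of_all _ fun x => by simp)

theorem MemContLp.conj {s : ℝ≥0∞} {F : ℝ × EuclideanSpace ℝ (Fin n) → ℂ}
    (hF : MemContLp T s F) : MemContLp T s (fun z => conj (F z)) := by
  refine ⟨Complex.continuous_conj.comp_aestronglyMeasurable hF.aestronglyMeasurable,
    fun t ht => (hF.memLp t ht).star, fun t₀ ht₀ => ?_⟩
  refine (hF.continuous t₀ ht₀).congr fun t => ?_
  refine eLpNorm_congr_norm_ae (ae_of_all _ fun x => ?_)
  simp only [← map_sub, RCLike.norm_conj]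

theorem MemXStar.conj {q' r' : ℝ≥0∞} {u : ℝ × EuclideanSpace ℝ (Fin n) → ℂ}
    (hu : MemXStar T q' r' u) : MemXStar T q' r' (fun z => conj (u z)) :=
  ⟨hu.memContLp.conj, hu.memMixedLp.conj⟩

/-! ### Spatial translations and correlation functions. -/

theorem eLpNorm_comp_add_right {s : ℝ≥0∞} {f : EuclideanSpace ℝ (Fin n) → ℂ}
    (hf : AEStronglyMeasurable f volume) (h : EuclideanSpace ℝ (Fin n)) :
    eLpNorm (fun x => f (x + h)) s volume = eLpNorm f s volume :=
  eLpNorm_comp_measurePreserving hf (measurePreserving_add_right volume h)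

theorem lintegral_enorm_mul_le_eLpNorm {α : Type*} [MeasurableSpace α] {κ : Measure α}
    {f g : α → ℂ} (hf : AEStronglyMeasurable f κ) (hg : AEStronglyMeasurable g κ) (p q : ℝ≥0∞)
    [ENNReal.HolderTriple p q 1] :
    ∫⁻ a, ‖f a‖ₑ * ‖g a‖ₑ ∂κ ≤ eLpNorm f p κ * eLpNorm g q κ := by
  have := eLpNorm_smul_le_mul_eLpNorm (r := 1) hg hf (p := p) (q := q)
  rw [eLpNorm_one_eq_lintegral_enorm] at this
  simpa [enorm_mul] using this

theorem eLpNorm_mul_le_eLpNorm_mul_eLpNorm {α : Type*} [MeasurableSpace α] {κ : Measure α}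
    {f g : α → ℂ} (hf : AEStronglyMeasurable f κ) (hg : AEStronglyMeasurable g κ) (p q r : ℝ≥0∞)
    [ENNReal.HolderTriple p q r] :
    eLpNorm (fun a => f a * g a) r κ ≤ eLpNorm f p κ * eLpNorm g q κ := by
  have h := eLpNorm_smul_le_mul_eLpNorm (p := p) (q := q) (r := r) hg hf
  have e : (f • g) = fun a => f a * g a := by ext a; simp
  rwa [e] at h

theorem MeasureTheory.MemLp.tendsto_eLpNorm_translate_sub {r : ℝ≥0∞} (hr : 1 ≤ r) (hr' : r ≠ ∞)
    {f : EuclideanSpace ℝ (Fin n) → ℂ} (hf : MemLp f r volume) :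
    Tendsto (fun h => eLpNorm (fun x => f (x + h) - f x) r volume) (𝓝 0) (𝓝 0) := by
  have : Fact (1 ≤ r) := ⟨hr⟩
  have : Fact (r ≠ ∞) := ⟨hr'⟩
  have hc : Continuous fun h : EuclideanSpace ℝ (Fin n) => DomAddAct.mk h +ᵥ hf.toLp f :=
    Continuous.vadd (DomAddAct.continuous_mk) continuous_const
  refine (tendsto_iff_edist_tendsto_0.1 (hc.tendsto 0)).congr fun h => ?_
  rw [DomAddAct.mk_vadd_toLp, DomAddAct.mk_vadd_toLp, Lp.edist_toLp_toLp]
  refine eLpNorm_congr_ae (ae_of_all _ fun x => ?_)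
  simp [add_comm h x]

theorem MeasureTheory.MemLp.continuousAt_integral_translate_mul {r s : ℝ≥0∞} (hr' : r ≠ ∞)
    [ENNReal.HolderTriple r s 1] {f g : EuclideanSpace ℝ (Fin n) → ℂ}
    (hf : MemLp f r volume) (hg : MemLp g s volume) :
    ContinuousAt (fun h => ∫ x, f (x + h) * g x) 0 := by
  have hr : 1 ≤ r := by
    have := ENNReal.HolderTriple.inv_add_inv_eq_inv r s 1
    rw [← ENNReal.inv_le_inv, ← this]
    exact le_self_add
  have hfh : ∀ h, MemLp (fun x => f (x + h)) r volume := fun h =>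
    hf.comp_measurePreserving (measurePreserving_add_right volume h)
  have hint : ∀ h, Integrable (fun x => f (x + h) * g x) := fun h =>
    memLp_one_iff_integrable.1 (MemLp.mul' hg (hfh h))
  rw [ContinuousAt, tendsto_iff_edist_tendsto_0]
  have hlim : Tendsto (fun h => eLpNorm (fun x => f (x + h) - f x) r volume * eLpNorm g s volume)
      (𝓝 0) (𝓝 0) := by
    simpa using ENNReal.Tendsto.mul_const (hf.tendsto_eLpNorm_translate_sub hr hr')
      (Or.inr hg.2.ne)
  refine tendsto_of_tendsto_of_tendsto_of_le_of_le tendsto_const_nhds hlim (fun _ => zero_le)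
    fun h => ?_
  simp only [edist_eq_enorm_sub]
  rw [← integral_sub (hint h) (hint 0)]
  refine (enorm_integral_le_lintegral_enorm _).trans ?_
  refine le_trans (le_of_eq (lintegral_congr fun x => ?_)) (lintegral_enorm_mul_le_eLpNorm
    (f := fun x => f (x + h) - f x) (g := g) ((hfh h).1.sub hf.1) hg.1 r s)
  rw [← enorm_mul, add_zero]
  congr 1; ring

/-- Two functions on the slab whose spatial translates can be paired, uniformly in the translation,
with a pairing which is continuous at the trivial translation. -/
structure HasCorrelation (T : ℝ) (f g : ℝ × EuclideanSpace ℝ (Fin n) → ℂ) : Prop where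
  left : AEStronglyMeasurable f (slabMeasure n T)
  right : AEStronglyMeasurable g (slabMeasure n T)
  bound : ∃ N : ℝ → ℝ≥0∞, AEMeasurable N (volume.restrict (Ioo 0 T)) ∧
    ∫⁻ t in Ioo 0 T, N t ≠ ∞ ∧ ∀ᵐ t ∂(volume.restrict (Ioo 0 T)),
      ∀ h, ∫⁻ x, ‖f (t, x + h)‖ₑ * ‖g (t, x)‖ₑ ≤ N t
  cont : ∀ᵐ t ∂(volume.restrict (Ioo 0 T)), ContinuousAt (fun h => ∫ x, f (t, x + h) * g (t, x)) 0

/-- The correlation function `h ↦ ∫ f(t, x + h) g(t, x)` over the slab. -/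
noncomputable def correlation (T : ℝ) (f g : ℝ × EuclideanSpace ℝ (Fin n) → ℂ)
    (h : EuclideanSpace ℝ (Fin n)) : ℂ :=
  ∫ z, f (z.1, z.2 + h) * g z ∂(slabMeasure n T)

/-- Hölder in space bounds the pairing at time `t` by the product of three slice norms; this does
not depend on `h`, since translations are isometries of `L^r`. Hölder in time makes the bound
integrable. Finiteness of `r` is what makes translation continuous in `L^r`. -/
theorem MemMixedLp.hasCorrelation {p₁ p₂ p₃ s₁ s₂ s₃ : ℝ≥0∞} (r : ℝ≥0∞)
    {f₁ f₂ g : ℝ × EuclideanSpace ℝ (Fin n) → ℂ} (h₁ : MemMixedLp T p₁ s₁ f₁)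
    (h₂ : MemMixedLp T p₂ s₂ f₂) (h₃ : MemMixedLp T p₃ s₃ g) (hp : p₁⁻¹ + p₂⁻¹ + p₃⁻¹ = 1)
    [ENNReal.HolderTriple s₁ s₂ r] [ENNReal.HolderTriple r s₃ 1] (hr : r ≠ ∞) :
    HasCorrelation T (fun z => f₁ z * f₂ z) g := by
  have n₁ : p₁ ≠ 0 := by rintro rfl; simp at hp
  have n₂ : p₂ ≠ 0 := by rintro rfl; simp at hp
  have n₃ : p₃ ≠ 0 := by rintro rfl; simp at hp
  have m₁ := aemeasurable_eLpNorm_slice h₁.aestronglyMeasurable' s₁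
  have m₂ := aemeasurable_eLpNorm_slice h₂.aestronglyMeasurable' s₂
  have m₃ := aemeasurable_eLpNorm_slice h₃.aestronglyMeasurable' s₃
  refine ⟨h₁.aestronglyMeasurable'.mul h₂.aestronglyMeasurable', h₃.aestronglyMeasurable',
    ⟨fun t => eLpNorm (fun x => f₁ (t, x)) s₁ volume * eLpNorm (fun x => f₂ (t, x)) s₂ volume *
      eLpNorm (fun x => g (t, x)) s₃ volume, (m₁.mul m₂).mul m₃,
      lintegral_mul_mul_lt_top hp m₁ m₂ m₃ h₁.norm_lt_top h₂.norm_lt_top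
      h₃.norm_lt_top, ?_⟩, ?_⟩
  · filter_upwards [h₁.ae_memLp n₁, h₂.ae_memLp n₂, h₃.ae_memLp n₃] with t l₁ l₂ l₃ h
    have hs : MemLp (fun x => f₁ (t, x) * f₂ (t, x)) r volume := MemLp.mul' l₂ l₁
    have hsh := (hs.comp_measurePreserving (measurePreserving_add_right volume h)).1
    refine (lintegral_enorm_mul_le_eLpNorm hsh l₃.1 r s₃).trans ?_
    refine mul_le_mul_left ?_ _
    refine (eLpNorm_comp_add_right hs.1 h).le.trans ?_
    exact eLpNorm_mul_le_eLpNorm_mul_eLpNorm l₁.1 l₂.1 s₁ s₂ r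
  · filter_upwards [h₁.ae_memLp n₁, h₂.ae_memLp n₂, h₃.ae_memLp n₃] with t l₁ l₂ l₃
    exact MemLp.continuousAt_integral_translate_mul (r := r) (s := s₃) hr (MemLp.mul' l₂ l₁) l₃

/-- Makes translates jointly measurable in the shift and the point: the map is a measure-preserving
shear followed by a projection. -/
theorem quasiMeasurePreserving_translate {A : Type*} [MeasurableSpace A] (κ : Measure A) [SFinite κ]
    {a : A → EuclideanSpace ℝ (Fin n)} (ha : Measurable a) :
    Measure.QuasiMeasurePreserving
      (fun w : A × (ℝ × EuclideanSpace ℝ (Fin n)) => (w.2.1, w.2.2 + a w.1))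
      (κ.prod (slabMeasure n T)) (slabMeasure n T) := by
  have h1 : MeasurePreserving (fun w : A × (ℝ × EuclideanSpace ℝ (Fin n)) =>
      (w.1, (w.2.1, w.2.2 + a w.1))) (κ.prod (slabMeasure n T)) (κ.prod (slabMeasure n T)) := by
    refine (MeasurePreserving.id κ).skew_product
      (g := fun b (z : ℝ × EuclideanSpace ℝ (Fin n)) => (z.1, z.2 + a b)) ?_ ?_
    · simp only [Function.uncurry_def]
      fun_prop
    · exact ae_of_all _ fun b =>
        ((MeasurePreserving.id _).prod (measurePreserving_add_right volume (a b))).map_eq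
  exact Measure.quasiMeasurePreserving_snd.comp h1.quasiMeasurePreserving

theorem measurePreserving_slab_translate (h : EuclideanSpace ℝ (Fin n)) :
    MeasurePreserving (fun z : ℝ × EuclideanSpace ℝ (Fin n) => (z.1, z.2 + h))
      (slabMeasure n T) (slabMeasure n T) :=
  (MeasurePreserving.id _).prod (measurePreserving_add_right volume h)

namespace HasCorrelation

variable {f f' g : ℝ × EuclideanSpace ℝ (Fin n) → ℂ}

theorem aestronglyMeasurable_translate_mul (H : HasCorrelation T f g)
    (h : EuclideanSpace ℝ (Fin n)) :
    AEStronglyMeasurable (fun z => f (z.1, z.2 + h) * g z) (slabMeasure n T) :=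
  (H.left.comp_measurePreserving (measurePreserving_slab_translate h)).mul H.right

theorem exists_lintegral_le (H : HasCorrelation T f g) :
    ∃ C : ℝ≥0∞, C ≠ ∞ ∧ ∀ h,
      ∫⁻ z, ‖f (z.1, z.2 + h)‖ₑ * ‖g z‖ₑ ∂(slabMeasure n T) ≤ C := by
  obtain ⟨N, hN, hN', hb⟩ := H.bound
  refine ⟨_, hN', fun h => ?_⟩
  have hm := (H.aestronglyMeasurable_translate_mul h).enorm
  simp only [enorm_mul] at hm
  rw [lintegral_prod _ hm]
  exact lintegral_mono_ae (hb.mono fun t ht => ht h)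

theorem integrable_translate_mul (H : HasCorrelation T f g) (h : EuclideanSpace ℝ (Fin n)) :
    Integrable (fun z => f (z.1, z.2 + h) * g z) (slabMeasure n T) := by
  obtain ⟨C, hC, hb⟩ := H.exists_lintegral_le
  refine ⟨H.aestronglyMeasurable_translate_mul h, ?_⟩
  refine lt_of_le_of_lt ?_ (lt_top_iff_ne_top.2 hC)
  simpa only [enorm_mul] using hb h

theorem integrable_mul (H : HasCorrelation T f g) :
    Integrable (fun z => f z * g z) (slabMeasure n T) := by
  simpa using H.integrable_translate_mul 0

theorem correlation_zero (f g : ℝ × EuclideanSpace ℝ (Fin n) → ℂ) :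
    correlation T f g 0 = ∫ z, f z * g z ∂(slabMeasure n T) := by
  simp [correlation]

/-- Dominated convergence in `t`: the slices are continuous at 0 and the dominating function does
not depend on `h`. -/
theorem continuousAt_correlation (H : HasCorrelation T f g) :
    ContinuousAt (correlation T f g) 0 := by
  obtain ⟨N, hN, hN', hb⟩ := H.bound
  have e : correlation T f g = fun h => ∫ t in Ioo 0 T, ∫ x, f (t, x + h) * g (t, x) := by
    ext h
    exact integral_prod _ (H.integrable_translate_mul h)
  rw [e]
  have hfin := ae_lt_top' hN hN'
  refine continuousAt_of_dominated (bound := fun t => (N t).toReal) ?_ ?_ ?_ H.cont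
  · exact Eventually.of_forall fun h =>
      (H.aestronglyMeasurable_translate_mul h).integral_prod_right'
  · refine Eventually.of_forall fun h => ?_
    filter_upwards [hb, hfin] with t ht ht'
    rw [← ENNReal.ofReal_le_ofReal_iff ENNReal.toReal_nonneg, ofReal_norm,
      ENNReal.ofReal_toReal ht'.ne]
    refine (enorm_integral_le_lintegral_enorm _).trans ?_
    simpa only [enorm_mul] using ht h
  · exact integrable_toReal_of_lintegral_ne_top hN hN'

theorem add_left (H : HasCorrelation T f g) (H' : HasCorrelation T f' g) :
    HasCorrelation T (fun z => f z + f' z) g := by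
  obtain ⟨N, hN, hN', hb⟩ := H.bound
  obtain ⟨M, hM, hM', hb'⟩ := H'.bound
  refine ⟨H.left.add H'.left, H.right, ⟨fun t => N t + M t, hN.add hM, ?_, ?_⟩, ?_⟩
  · rw [lintegral_add_left' hN]
    exact ENNReal.add_ne_top.2 ⟨hN', hM'⟩
  · filter_upwards [hb, hb', H.left.prodMk_left, H.right.prodMk_left] with t h1 h2 h3 h4 h
    refine le_trans ?_ (add_le_add (h1 h) (h2 h))
    rw [← lintegral_add_left']
    · refine lintegral_mono fun x => ?_
      rw [← add_mul]
      exact mul_le_mul_left (enorm_add_le _ _) _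
    · exact ((h3.comp_measurePreserving (measurePreserving_add_right volume h)).enorm).mul h4.enorm
  · have key : ∀ {f₁ : ℝ × EuclideanSpace ℝ (Fin n) → ℂ} (H₁ : HasCorrelation T f₁ g),
        ∀ᵐ t ∂(volume.restrict (Ioo 0 T)), ∀ h, Integrable fun x => f₁ (t, x + h) * g (t, x) := by
      intro f₁ H₁
      obtain ⟨N, hN, hN', hb⟩ := H₁.bound
      filter_upwards [hb, ae_lt_top' hN hN', H₁.left.prodMk_left, H₁.right.prodMk_left] with
        t h1 h2 h3 h4 h
      refine ⟨(h3.comp_measurePreserving (measurePreserving_add_right volume h)).mul h4, ?_⟩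
      refine lt_of_le_of_lt ?_ h2
      simpa only [enorm_mul] using h1 h
    filter_upwards [H.cont, H'.cont, key H, key H'] with t h1 h2 h3 h4
    refine (h1.add h2).congr (Eventually.of_forall fun h => ?_)
    simp only [Pi.add_apply]
    rw [← integral_add (h3 h) (h4 h)]
    congr 1; ext x; ring

theorem congr_left (H : HasCorrelation T f g) (h : f =ᵐ[slabMeasure n T] f') :
    HasCorrelation T f' g := by
  obtain ⟨N, hN, hN', hb⟩ := H.bound
  have hae := Measure.ae_ae_of_ae_prod h
  have hae' : ∀ᵐ t ∂(volume.restrict (Ioo 0 T)), ∀ h : EuclideanSpace ℝ (Fin n),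
      ∀ᵐ x, f (t, x + h) = f' (t, x + h) := by
    filter_upwards [hae] with t ht h
    exact (measurePreserving_add_right volume h).quasiMeasurePreserving.ae ht
  refine ⟨H.left.congr h, H.right, ⟨N, hN, hN', ?_⟩, ?_⟩
  · filter_upwards [hb, hae'] with t h1 h2 h
    refine (lintegral_congr_ae ?_).trans_le (h1 h)
    filter_upwards [h2 h] with x hx
    rw [hx]
  · filter_upwards [H.cont, hae'] with t h1 h2
    refine h1.congr (Eventually.of_forall fun h => integral_congr_ae ?_)
    filter_upwards [h2 h] with x hx
    rw [hx]

/-- Substituting `x ↦ x + h` moves the translation to the other factor with opposite sign. -/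
theorem symm (H : HasCorrelation T f g) : HasCorrelation T g f := by
  obtain ⟨N, hN, hN', hb⟩ := H.bound
  refine ⟨H.right, H.left, ⟨N, hN, hN', ?_⟩, ?_⟩
  · filter_upwards [hb] with t h1 h
    refine le_trans (le_of_eq ?_) (h1 (-h))
    rw [← lintegral_add_right_eq_self (fun x => ‖f (t, x + -h)‖ₑ * ‖g (t, x)‖ₑ) h]
    simp [mul_comm]
  · filter_upwards [H.cont] with t h1
    have h2 : ContinuousAt (fun h : EuclideanSpace ℝ (Fin n) => -h) 0 := continuousAt_neg
    have h3 := ContinuousAt.comp (f := fun h : EuclideanSpace ℝ (Fin n) => -h) (x := 0)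
      (by simpa using h1) h2
    refine h3.congr (Eventually.of_forall fun h => ?_)
    simp only [Function.comp_apply]
    rw [← integral_add_right_eq_self (fun x => f (t, x + -h) * g (t, x)) h]
    simp [mul_comm]

end HasCorrelation

/-! ### Convolution in space, expressed through correlations. -/

theorem measurableEmbedding_translate_snd (h : EuclideanSpace ℝ (Fin n)) :
    MeasurableEmbedding (fun z : ℝ × EuclideanSpace ℝ (Fin n) => (z.1, z.2 + h)) :=
  ((MeasurableEquiv.refl ℝ).prodCongr (MeasurableEquiv.addRight h)).measurableEmbedding

theorem lintegral_slab_translate (k : ℝ × EuclideanSpace ℝ (Fin n) → ℝ≥0∞)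
    (h : EuclideanSpace ℝ (Fin n)) :
    ∫⁻ z, k (z.1, z.2 + h) ∂(slabMeasure n T) = ∫⁻ z, k z ∂(slabMeasure n T) :=
  (measurePreserving_slab_translate h).lintegral_comp_emb (measurableEmbedding_translate_snd h) k

theorem integral_slab_translate (k : ℝ × EuclideanSpace ℝ (Fin n) → ℂ)
    (h : EuclideanSpace ℝ (Fin n)) :
    ∫ z, k (z.1, z.2 + h) ∂(slabMeasure n T) = ∫ z, k z ∂(slabMeasure n T) :=
  (measurePreserving_slab_translate h).integral_comp (measurableEmbedding_translate_snd h) k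

/-- Convolution in the space variable. -/
noncomputable def spatialConv (ρ : EuclideanSpace ℝ (Fin n) → ℝ)
    (f : ℝ × EuclideanSpace ℝ (Fin n) → ℂ) (z : ℝ × EuclideanSpace ℝ (Fin n)) : ℂ :=
  ∫ p, (ρ p : ℂ) * f (z.1, z.2 - p)

theorem spatialConv_eq (ρ : EuclideanSpace ℝ (Fin n) → ℝ)
    (f : ℝ × EuclideanSpace ℝ (Fin n) → ℂ) (t : ℝ) (y : EuclideanSpace ℝ (Fin n)) :
    spatialConv ρ f (t, y) = ∫ x, f (t, x) * (ρ (y - x) : ℂ) := by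
  rw [spatialConv, ← integral_sub_left_eq_self _ volume y]
  simp [mul_comm]

theorem spatialConv_conj (ρ : EuclideanSpace ℝ (Fin n) → ℝ)
    (f : ℝ × EuclideanSpace ℝ (Fin n) → ℂ) (z : ℝ × EuclideanSpace ℝ (Fin n)) :
    spatialConv ρ (fun z => conj (f z)) z = conj (spatialConv ρ f z) := by
  simp only [spatialConv]
  rw [← integral_conj]
  simp

namespace HasCorrelation

variable {f g : ℝ × EuclideanSpace ℝ (Fin n) → ℂ} {ρ σ : EuclideanSpace ℝ (Fin n) → ℝ}

/-- Justifies every later use of Fubini: integrating over the slab first leaves at most `C |ρ(p)|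
|σ(q)|`, with `C` the bound uniform in translations. -/
theorem integrable_tensor (H : HasCorrelation T f g) (hρ : Integrable ρ) (hσ : Integrable σ) :
    Integrable (fun w : (EuclideanSpace ℝ (Fin n) × EuclideanSpace ℝ (Fin n)) ×
        (ℝ × EuclideanSpace ℝ (Fin n)) =>
      ((ρ w.1.1 : ℂ) * f (w.2.1, w.2.2 - w.1.1)) * ((σ w.1.2 : ℂ) * g (w.2.1, w.2.2 - w.1.2)))
      ((volume.prod volume).prod (slabMeasure n T)) := by
  have hm : AEStronglyMeasurable (fun w : (EuclideanSpace ℝ (Fin n) × EuclideanSpace ℝ (Fin n)) ×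
        (ℝ × EuclideanSpace ℝ (Fin n)) =>
      ((ρ w.1.1 : ℂ) * f (w.2.1, w.2.2 - w.1.1)) * ((σ w.1.2 : ℂ) * g (w.2.1, w.2.2 - w.1.2)))
      ((volume.prod volume).prod (slabMeasure n T)) := by
    have q₁ := quasiMeasurePreserving_translate (n := n) (T := T)
      (A := EuclideanSpace ℝ (Fin n) × EuclideanSpace ℝ (Fin n)) (volume.prod volume)
      (a := fun b => -b.1) measurable_fst.neg
    have q₂ := quasiMeasurePreserving_translate (n := n) (T := T)
      (A := EuclideanSpace ℝ (Fin n) × EuclideanSpace ℝ (Fin n)) (volume.prod volume)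
      (a := fun b => -b.2) measurable_snd.neg
    have m₁ : AEStronglyMeasurable
        (fun w : (EuclideanSpace ℝ (Fin n) × EuclideanSpace ℝ (Fin n)) ×
          (ℝ × EuclideanSpace ℝ (Fin n)) => (ρ w.1.1 : ℂ))
        ((volume.prod volume).prod (slabMeasure n T)) :=
      (hρ.ofReal (𝕜 := ℂ)).1.comp_fst.comp_fst
    have m₂ : AEStronglyMeasurable
        (fun w : (EuclideanSpace ℝ (Fin n) × EuclideanSpace ℝ (Fin n)) ×
          (ℝ × EuclideanSpace ℝ (Fin n)) => (σ w.1.2 : ℂ))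
        ((volume.prod volume).prod (slabMeasure n T)) :=
      (hσ.ofReal (𝕜 := ℂ)).1.comp_snd.comp_fst
    have m₃ := H.left.comp_quasiMeasurePreserving q₁
    have m₄ := H.right.comp_quasiMeasurePreserving q₂
    simpa only [sub_eq_add_neg, Function.comp_def] using! (m₁.mul m₃).mul (m₂.mul m₄)
  obtain ⟨C, hC, hb⟩ := H.exists_lintegral_le
  refine ⟨hm, ?_⟩
  rw [HasFiniteIntegral, lintegral_prod _ hm.enorm]
  have hin : ∀ b : EuclideanSpace ℝ (Fin n) × EuclideanSpace ℝ (Fin n),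
      ∫⁻ z, ‖((ρ b.1 : ℂ) * f (z.1, z.2 - b.1)) * ((σ b.2 : ℂ) * g (z.1, z.2 - b.2))‖ₑ
        ∂(slabMeasure n T) ≤ ‖ρ b.1‖ₑ * ‖σ b.2‖ₑ * C := by
    intro b
    have e : ∀ z : ℝ × EuclideanSpace ℝ (Fin n),
        ‖((ρ b.1 : ℂ) * f (z.1, z.2 - b.1)) * ((σ b.2 : ℂ) * g (z.1, z.2 - b.2))‖ₑ
        = ‖ρ b.1‖ₑ * ‖σ b.2‖ₑ * (‖f (z.1, z.2 - b.1)‖ₑ * ‖g (z.1, z.2 - b.2)‖ₑ) := by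
      intro z
      have c₁ : ‖(ρ b.1 : ℂ)‖ₑ = ‖ρ b.1‖ₑ := by simp [← ofReal_norm]
      have c₂ : ‖(σ b.2 : ℂ)‖ₑ = ‖σ b.2‖ₑ := by simp [← ofReal_norm]
      simp only [enorm_mul, c₁, c₂]
      ring
    simp_rw [e]
    rw [lintegral_const_mul' _ _ (ENNReal.mul_ne_top enorm_ne_top enorm_ne_top)]
    refine mul_le_mul_right ?_ _
    -- Translating by `q = b.2` leaves only the relative shift `q - p`.
    rw [← lintegral_slab_translate _ b.2]
    simpa [add_sub_assoc] using hb (b.2 - b.1)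
  refine (lintegral_mono hin).trans_lt ?_
  rw [lintegral_mul_const' _ _ hC, lintegral_prod_mul hρ.1.enorm hσ.1.enorm]
  exact ENNReal.mul_lt_top (ENNReal.mul_lt_top hρ.2 hσ.2) (lt_top_iff_ne_top.2 hC)

theorem integral_tensor_eq (ρ σ : EuclideanSpace ℝ (Fin n) → ℝ)
    (f g : ℝ × EuclideanSpace ℝ (Fin n) → ℂ) (z : ℝ × EuclideanSpace ℝ (Fin n)) :
    ∫ b : EuclideanSpace ℝ (Fin n) × EuclideanSpace ℝ (Fin n),
      ((ρ b.1 : ℂ) * f (z.1, z.2 - b.1)) * ((σ b.2 : ℂ) * g (z.1, z.2 - b.2))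
        ∂(volume.prod volume) = spatialConv ρ f z * spatialConv σ g z :=
  integral_prod_mul (fun p => (ρ p : ℂ) * f (z.1, z.2 - p)) fun q => (σ q : ℂ) * g (z.1, z.2 - q)

theorem integrable_spatialConv_mul (H : HasCorrelation T f g) (hρ : Integrable ρ)
    (hσ : Integrable σ) :
    Integrable (fun z => spatialConv ρ f z * spatialConv σ g z) (slabMeasure n T) := by
  have := (H.integrable_tensor hρ hσ).integral_prod_right
  simpa only [integral_tensor_eq] using this

theorem integral_spatialConv_mul (H : HasCorrelation T f g) (hρ : Integrable ρ)
    (hσ : Integrable σ) :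
    ∫ z, spatialConv ρ f z * spatialConv σ g z ∂(slabMeasure n T) =
      ∫ b : EuclideanSpace ℝ (Fin n) × EuclideanSpace ℝ (Fin n),
        (ρ b.1 : ℂ) * (σ b.2 : ℂ) * correlation T f g (b.2 - b.1) ∂(volume.prod volume) := by
  simp_rw [← integral_tensor_eq]
  rw [← integral_integral_swap (H.integrable_tensor hρ hσ)]
  refine integral_congr_ae (ae_of_all _ fun b => ?_)
  simp only [correlation]
  rw [← integral_slab_translate _ b.2, ← integral_const_mul]
  refine integral_congr_ae (ae_of_all _ fun z => ?_)
  simp only [add_sub_cancel_right, add_sub_assoc]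
  ring

/-- The substitution `(p, q) ↦ (-q, -p)` preserves `q - p` and exchanges the roles of the two even
kernels. With `Δρ` as one kernel, this replaces Green's identity. -/
theorem integral_spatialConv_mul_comm (H : HasCorrelation T f g) (hρ : Integrable ρ)
    (hσ : Integrable σ) (hρ' : ∀ x, ρ (-x) = ρ x) (hσ' : ∀ x, σ (-x) = σ x) :
    ∫ z, spatialConv ρ f z * spatialConv σ g z ∂(slabMeasure n T) =
      ∫ z, spatialConv σ f z * spatialConv ρ g z ∂(slabMeasure n T) := by
  rw [H.integral_spatialConv_mul hρ hσ, H.integral_spatialConv_mul hσ hρ]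
  rw [← integral_prod_swap]
  have hneg : MeasurePreserving (fun b : EuclideanSpace ℝ (Fin n) × EuclideanSpace ℝ (Fin n) =>
      (-b.1, -b.2)) (volume.prod volume) (volume.prod volume) :=
    (Measure.measurePreserving_neg volume).prod (Measure.measurePreserving_neg volume)
  have hemb : MeasurableEmbedding
      (fun b : EuclideanSpace ℝ (Fin n) × EuclideanSpace ℝ (Fin n) => (-b.1, -b.2)) :=
    ((MeasurableEquiv.neg _).prodCongr (MeasurableEquiv.neg _)).measurableEmbedding
  rw [← hneg.integral_comp hemb]
  refine integral_congr_ae (ae_of_all _ fun b => ?_)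
  simp only [Prod.fst_swap, Prod.snd_swap, hρ', hσ']
  rw [neg_sub_neg]
  ring

/-- The integral is an average of `C(q - p)` for a probability density concentrating at `p = q = 0`,
and `C` is continuous at 0. -/
theorem tendsto_integral_spatialConv_mul (H : HasCorrelation T f g)
    {ρ : ℕ → ContDiffBump (0 : EuclideanSpace ℝ (Fin n))}
    (hρ : Tendsto (fun k => (ρ k).rOut) atTop (𝓝 0)) :
    Tendsto (fun k => ∫ z, spatialConv ((ρ k).normed volume) f z *
        spatialConv ((ρ k).normed volume) g z ∂(slabMeasure n T)) atTop
      (𝓝 (∫ z, f z * g z ∂(slabMeasure n T))) := by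
  rw [← correlation_zero, Metric.tendsto_atTop]
  intro ε hε
  obtain ⟨δ, hδ, hδ'⟩ := Metric.continuousAt_iff.1 H.continuousAt_correlation
    (ε / 2) (by positivity)
  -- Radius below `δ / 2`, since the difference of two points of the support must have norm below
  -- `δ`.
  obtain ⟨K, hK⟩ := eventually_atTop.1 (hρ.eventually (gt_mem_nhds (half_pos hδ)))
  refine ⟨K, fun k hk => ?_⟩
  set η := (ρ k).normed (volume : Measure (EuclideanSpace ℝ (Fin n))) with hη
  have hηI : Integrable η := (ρ k).integrable_normed
  have hηc : Integrable (fun p => (η p : ℂ)) := hηI.ofReal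
  have hη1 : ∫ p, (η p : ℂ) = 1 := by
    have h1 : ∫ p, (η p : ℂ) = ((∫ p, η p : ℝ) : ℂ) := integral_ofReal
    rw [h1, (ρ k).integral_normed, Complex.ofReal_one]
  have hprod : ∫ b : EuclideanSpace ℝ (Fin n) × EuclideanSpace ℝ (Fin n),
      (η b.1 : ℂ) * (η b.2 : ℂ) ∂(volume.prod volume) = 1 := by
    rw [integral_prod_mul (fun p => (η p : ℂ)) fun q => (η q : ℂ), hη1, one_mul]
  have hI : Integrable (fun b : EuclideanSpace ℝ (Fin n) × EuclideanSpace ℝ (Fin n) =>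
      (η b.1 : ℂ) * (η b.2 : ℂ)) (volume.prod volume) := hηc.mul_prod hηc
  have hIc : Integrable (fun b : EuclideanSpace ℝ (Fin n) × EuclideanSpace ℝ (Fin n) =>
      (η b.1 : ℂ) * (η b.2 : ℂ) * correlation T f g (b.2 - b.1)) (volume.prod volume) := by
    have h1 := (H.integrable_tensor hηI hηI).integral_prod_left
    refine h1.congr (ae_of_all _ fun b => ?_)
    simp only [correlation]
    rw [← integral_slab_translate _ b.2, ← integral_const_mul]
    refine integral_congr_ae (ae_of_all _ fun z => ?_)
    simp only [add_sub_cancel_right, add_sub_assoc]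
    ring
  rw [H.integral_spatialConv_mul hηI hηI, dist_eq_norm]
  have e1 : correlation T f g 0 = ∫ b : EuclideanSpace ℝ (Fin n) × EuclideanSpace ℝ (Fin n),
      (η b.1 : ℂ) * (η b.2 : ℂ) * correlation T f g 0 ∂(volume.prod volume) := by
    rw [integral_mul_const, hprod, one_mul]
  rw [e1, ← integral_sub hIc (hI.mul_const _)]
  have hIr : Integrable (fun b : EuclideanSpace ℝ (Fin n) × EuclideanSpace ℝ (Fin n) =>
      η b.1 * η b.2) (volume.prod volume) := hηI.mul_prod hηI
  have hle : ‖∫ b : EuclideanSpace ℝ (Fin n) × EuclideanSpace ℝ (Fin n),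
      ((η b.1 : ℂ) * (η b.2 : ℂ) * correlation T f g (b.2 - b.1) -
        (η b.1 : ℂ) * (η b.2 : ℂ) * correlation T f g 0) ∂(volume.prod volume)‖
      ≤ ∫ b : EuclideanSpace ℝ (Fin n) × EuclideanSpace ℝ (Fin n),
        η b.1 * η b.2 * (ε / 2) ∂(volume.prod volume) := by
    refine norm_integral_le_of_norm_le (hIr.mul_const _) (ae_of_all _ fun b => ?_)
    have hn : ∀ p, 0 ≤ η p := (ρ k).nonneg_normed
    rw [← mul_sub, norm_mul, norm_mul, Complex.norm_real, Complex.norm_real,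
      Real.norm_of_nonneg (hn _), Real.norm_of_nonneg (hn _)]
    by_cases hb : b.1 ∈ Function.support η ∧ b.2 ∈ Function.support η
    · refine mul_le_mul_of_nonneg_left ?_ (mul_nonneg (hn _) (hn _))
      rw [hη, (ρ k).support_normed_eq] at hb
      have h1 := mem_ball_zero_iff.1 hb.1
      have h2 := mem_ball_zero_iff.1 hb.2
      have h3 : dist (b.2 - b.1) 0 < δ := by
        rw [dist_zero_right]
        have := norm_sub_le b.2 b.1
        have := hK k hk
        linarith
      rw [← dist_eq_norm]
      exact (hδ' h3).le
    · have h0 : η b.1 * η b.2 = 0 := by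
        simp only [Function.mem_support] at hb
        by_contra hcon
        exact hb ⟨left_ne_zero_of_mul hcon, right_ne_zero_of_mul hcon⟩
      simp [h0]
  refine hle.trans_lt ?_
  rw [integral_mul_const, integral_prod_mul η η, (ρ k).integral_normed]
  linarith

end HasCorrelation

/-! ### The Laplacian of a reflected kernel and of product test functions. -/

open Laplacian in
theorem laplacian_comp_const_sub {F : Type*} [NormedAddCommGroup F] [NormedSpace ℝ F]
    {f : EuclideanSpace ℝ (Fin n) → F} (y x : EuclideanSpace ℝ (Fin n)) :
    (Δ fun x => f (y - x)) x = (Δ f) (y - x) := by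
  have e : (fun x => f (y - x)) = (fun x => f (y + x)) ∘
      (ContinuousLinearEquiv.neg ℝ : EuclideanSpace ℝ (Fin n) ≃L[ℝ] _) := by
    ext x; simp [sub_eq_add_neg]
  simp only [InnerProductSpace.laplacian_eq_iteratedFDeriv_stdOrthonormalBasis]
  refine Finset.sum_congr rfl fun i _ => ?_
  have r := (ContinuousLinearEquiv.neg ℝ :
      EuclideanSpace ℝ (Fin n) ≃L[ℝ] _).iteratedFDerivWithin_comp_right
    (fun x => f (y + x)) uniqueDiffOn_univ (x := x) (mem_univ _) 2
  rw [preimage_univ, iteratedFDerivWithin_univ, iteratedFDerivWithin_univ] at r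
  rw [e, r, iteratedFDeriv_comp_add_left]
  simp only [ContinuousLinearEquiv.neg_apply,
    ContinuousMultilinearMap.compContinuousLinearMap_apply, ← sub_eq_add_neg]
  have e2 : (fun j : Fin 2 => (ContinuousLinearEquiv.neg ℝ : EuclideanSpace ℝ (Fin n) ≃L[ℝ] _)
      (![stdOrthonormalBasis ℝ (EuclideanSpace ℝ (Fin n)) i,
        stdOrthonormalBasis ℝ (EuclideanSpace ℝ (Fin n)) i] j)) =
      fun j => (-1 : ℝ) • ![stdOrthonormalBasis ℝ (EuclideanSpace ℝ (Fin n)) i,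
        stdOrthonormalBasis ℝ (EuclideanSpace ℝ (Fin n)) i] j := by
    ext j; simp
  -- The two signs of the reflection multiply to 1 in a second derivative.
  have e3 := (iteratedFDeriv ℝ 2 f (y - x)).map_smul_univ (fun _ => (-1 : ℝ))
    ![stdOrthonormalBasis ℝ (EuclideanSpace ℝ (Fin n)) i,
        stdOrthonormalBasis ℝ (EuclideanSpace ℝ (Fin n)) i]
  rw [← e2] at e3
  refine Eq.trans ?_ (e3.trans (by simp))
  rfl

open Laplacian in
theorem continuous_laplacian {ρ : EuclideanSpace ℝ (Fin n) → ℝ} (hρ : ContDiff ℝ (⊤ : ℕ∞) ρ) :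
    Continuous (Δ ρ) := by
  rw [InnerProductSpace.laplacian_eq_iteratedFDeriv_stdOrthonormalBasis]
  refine continuous_finsetSum _ fun i _ => ?_
  have := hρ.continuous_iteratedFDeriv (m := 2) (WithTop.coe_le_coe.2 le_top)
  exact (ContinuousMultilinearMap.apply ℝ (fun _ : Fin 2 => EuclideanSpace ℝ (Fin n)) ℝ
    ![stdOrthonormalBasis ℝ (EuclideanSpace ℝ (Fin n)) i,
      stdOrthonormalBasis ℝ (EuclideanSpace ℝ (Fin n)) i]).continuous.comp this

open Laplacian in
theorem HasCompactSupport.laplacian {ρ : EuclideanSpace ℝ (Fin n) → ℝ}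
    (hρ : HasCompactSupport ρ) : HasCompactSupport (Δ ρ) := by
  refine (hρ.iteratedFDeriv (𝕜 := ℝ) 2).mono fun x hx => ?_
  contrapose! hx
  simp only [Function.mem_support, not_not] at hx ⊢
  rw [InnerProductSpace.laplacian_eq_iteratedFDeriv_stdOrthonormalBasis]
  simp [hx]

open Laplacian in
theorem laplacian_neg_of_even {ρ : EuclideanSpace ℝ (Fin n) → ℝ} (h : ∀ x, ρ (-x) = ρ x)
    (x : EuclideanSpace ℝ (Fin n)) : (Δ ρ) (-x) = (Δ ρ) x := by
  have := laplacian_comp_const_sub (f := ρ) 0 x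
  simp only [zero_sub, h] at this
  exact this.symm

open Laplacian in
theorem transposeSchrodinger_mul {θ : ℝ → ℝ} {ρ : EuclideanSpace ℝ (Fin n) → ℝ}
    (hθ : ContDiff ℝ (⊤ : ℕ∞) θ) (hρ : ContDiff ℝ (⊤ : ℕ∞) ρ) (y : EuclideanSpace ℝ (Fin n))
    (z : ℝ × EuclideanSpace ℝ (Fin n)) :
    transposeSchrodinger (fun z => (θ z.1 : ℂ) * (ρ (y - z.2) : ℂ)) z =
      -Complex.I * ((deriv θ z.1 : ℝ) : ℂ) * (ρ (y - z.2) : ℂ)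
        + (θ z.1 : ℂ) * ((Δ ρ (y - z.2) : ℝ) : ℂ) := by
  have h1 : deriv (fun t : ℝ => (θ t : ℂ) * (ρ (y - z.2) : ℂ)) z.1 =
      ((deriv θ z.1 : ℝ) : ℂ) * (ρ (y - z.2) : ℂ) :=
    (((hθ.differentiable (by simp)) z.1).hasDerivAt.ofReal_comp.mul_const _).deriv
  have hρy : ContDiff ℝ (⊤ : ℕ∞) fun x => ρ (y - x) := hρ.comp (contDiff_const.sub contDiff_id)
  have h2 : (Δ fun x : EuclideanSpace ℝ (Fin n) => (θ z.1 : ℂ) * (ρ (y - x) : ℂ)) z.2 =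
      (θ z.1 : ℂ) * ((Δ ρ (y - z.2) : ℝ) : ℂ) := by
    have e : (fun x : EuclideanSpace ℝ (Fin n) => (θ z.1 : ℂ) * (ρ (y - x) : ℂ)) =
        ((θ z.1) • Complex.ofRealCLM : ℝ →L[ℝ] ℂ) ∘ fun x => ρ (y - x) := by
      ext x; simp
    rw [e, (hρy.contDiffAt.of_le (WithTop.coe_le_coe.2 le_top)).laplacian_CLM_comp_left]
    simp [laplacian_comp_const_sub]
  simp only [transposeSchrodinger, h1, h2]
  ring

/-! ### Time evolution of mollified solutions. -/

/-- After convolution in space with a test function, `u` satisfies `∂ₜ u = c (Δ u - F)` in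
integrated form. -/
structure SpatialEvolution (T : ℝ) (c : ℂ) (u F : ℝ × EuclideanSpace ℝ (Fin n) → ℂ) : Prop where
  integrableOn_laplacian : ∀ ρ : EuclideanSpace ℝ (Fin n) → ℝ, ContDiff ℝ (⊤ : ℕ∞) ρ →
    HasCompactSupport ρ → ∀ y,
      IntegrableOn (fun s => spatialConv (Laplacian.laplacian ρ) u (s, y)) (Ioo 0 T)
  integrableOn_source : ∀ ρ : EuclideanSpace ℝ (Fin n) → ℝ, ContDiff ℝ (⊤ : ℕ∞) ρ →
    HasCompactSupport ρ → ∀ y, IntegrableOn (fun s => spatialConv ρ F (s, y)) (Ioo 0 T)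
  eq_add_integral : ∀ ρ : EuclideanSpace ℝ (Fin n) → ℝ, ContDiff ℝ (⊤ : ℕ∞) ρ →
    HasCompactSupport ρ → ∀ y, ∀ t ∈ Icc 0 T, spatialConv ρ u (t, y) = spatialConv ρ u (0, y) +
      ∫ s in 0..t, c * (spatialConv (Laplacian.laplacian ρ) u (s, y) - spatialConv ρ F (s, y))

theorem SpatialEvolution.conj {c : ℂ} {u F : ℝ × EuclideanSpace ℝ (Fin n) → ℂ}
    (h : SpatialEvolution T c u F) :
    SpatialEvolution T (conj c) (fun z => conj (u z)) (fun z => conj (F z)) := by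
  have hc : ∀ {k : ℝ → ℂ}, IntegrableOn k (Ioo 0 T) →
      IntegrableOn (fun s => (starRingEnd ℂ) (k s)) (Ioo 0 T) := fun {k} hk =>
    ⟨Complex.continuous_conj.comp_aestronglyMeasurable hk.1, by
      simpa [HasFiniteIntegral, ← ofReal_norm] using hk.2⟩
  refine ⟨fun ρ h1 h2 y => ?_, fun ρ h1 h2 y => ?_, fun ρ h1 h2 y t ht => ?_⟩
  · simp only [spatialConv_conj]
    exact hc (h.integrableOn_laplacian ρ h1 h2 y)
  · simp only [spatialConv_conj]
    exact hc (h.integrableOn_source ρ h1 h2 y)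
  · simp only [spatialConv_conj]
    rw [h.eq_add_integral ρ h1 h2 y t ht, map_add, intervalIntegral.integral_of_le ht.1,
      intervalIntegral.integral_of_le ht.1, ← integral_conj]
    simp

/-- Fubini turns a pairing with `θ(t) χ(y - x)` over the slab into a pairing of `θ` with the
mollified function at the point `y`. -/
theorem HasCorrelation.integral_mul_test {f : ℝ × EuclideanSpace ℝ (Fin n) → ℂ}
    {χ : EuclideanSpace ℝ (Fin n) → ℝ} {y : EuclideanSpace ℝ (Fin n)}
    (H : HasCorrelation T f (fun z => (χ (y - z.2) : ℂ))) :
    IntegrableOn (fun s => spatialConv χ f (s, y)) (Ioo 0 T) ∧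
    ∀ θ : ℝ → ℝ, Continuous θ → HasCompactSupport θ →
      Integrable (fun z => (θ z.1 : ℂ) * (f z * (χ (y - z.2) : ℂ))) (slabMeasure n T) ∧
      IntegrableOn (fun s => (θ s : ℂ) * spatialConv χ f (s, y)) (Ioo 0 T) ∧
      ∫ z, (θ z.1 : ℂ) * (f z * (χ (y - z.2) : ℂ)) ∂(slabMeasure n T) =
        ∫ s in Ioo 0 T, (θ s : ℂ) * spatialConv χ f (s, y) := by
  have h1 : IntegrableOn (fun s => spatialConv χ f (s, y)) (Ioo 0 T) := by
    have := H.integrable_mul.integral_prod_left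
    simpa only [spatialConv_eq, IntegrableOn] using this
  refine ⟨h1, fun θ hθ hθc => ?_⟩
  obtain ⟨C, hC⟩ := hθ.bounded_above_of_compact_support hθc
  have hint : Integrable (fun z => (θ z.1 : ℂ) * (f z * (χ (y - z.2) : ℂ))) (slabMeasure n T) := by
    refine H.integrable_mul.bdd_mul (c := C) ?_ ?_
    · exact (Complex.continuous_ofReal.comp (hθ.comp continuous_fst)).aestronglyMeasurable
    · exact ae_of_all _ fun z => by simpa using hC z.1
  refine ⟨hint, ?_, ?_⟩
  · refine h1.bdd_mul (c := C) ?_ ?_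
    · exact (Complex.continuous_ofReal.comp hθ).aestronglyMeasurable
    · exact ae_of_all _ fun z => by simpa using hC z
  · rw [integral_prod _ hint]
    refine integral_congr_ae (ae_of_all _ fun s => ?_)
    simp only [spatialConv_eq]
    rw [integral_const_mul]

theorem memLp_test {χ : EuclideanSpace ℝ (Fin n) → ℝ} (hχ : Continuous χ)
    (hχc : HasCompactSupport χ) (y : EuclideanSpace ℝ (Fin n)) (s : ℝ≥0∞) :
    MemLp (fun x => (χ (y - x) : ℂ)) s volume := by
  have h1 : Continuous fun x => (χ (y - x) : ℂ) :=
    Complex.continuous_ofReal.comp (hχ.comp (continuous_const.sub continuous_id))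
  refine h1.memLp_of_hasCompactSupport ?_
  have h2 : HasCompactSupport fun x => χ (y - x) :=
    hχc.comp_homeomorph (Homeomorph.subLeft y)
  exact h2.comp_left (g := fun r : ℝ => (r : ℂ)) (by simp)

theorem MemContLp.continuousOn_spatialConv {u : ℝ × EuclideanSpace ℝ (Fin n) → ℂ}
    (hu : MemContLp T 2 u) {χ : EuclideanSpace ℝ (Fin n) → ℝ} (hχ : Continuous χ)
    (hχc : HasCompactSupport χ) (y : EuclideanSpace ℝ (Fin n)) :
    ContinuousOn (fun t => spatialConv χ u (t, y)) (Icc 0 T) := by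
  have hχ2 := memLp_test hχ hχc y 2
  have hint : ∀ t ∈ Icc 0 T, Integrable fun x => u (t, x) * (χ (y - x) : ℂ) := fun t ht =>
    memLp_one_iff_integrable.1 (MemLp.mul' hχ2 (hu.memLp t ht))
  intro t₀ ht₀
  rw [ContinuousWithinAt, tendsto_iff_edist_tendsto_0]
  have hlim := ENNReal.Tendsto.mul_const (b := eLpNorm (fun x => (χ (y - x) : ℂ)) 2 volume)
    (hu.continuous t₀ ht₀) (Or.inr hχ2.2.ne)
  rw [zero_mul] at hlim
  refine tendsto_of_tendsto_of_tendsto_of_le_of_le' tendsto_const_nhds hlim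
    (Eventually.of_forall fun _ => zero_le) ?_
  filter_upwards [self_mem_nhdsWithin] with t ht
  simp only [edist_eq_enorm_sub, spatialConv_eq]
  rw [← integral_sub (hint t ht) (hint t₀ ht₀)]
  refine (enorm_integral_le_lintegral_enorm _).trans ?_
  refine le_trans (le_of_eq (lintegral_congr fun x => ?_)) (lintegral_enorm_mul_le_eLpNorm
    (((hu.memLp t ht).1).sub (hu.memLp t₀ ht₀).1) hχ2.1 2 2)
  rw [← enorm_mul]
  congr 1
  simp only [Pi.sub_apply]
  ring

/-- Test functions `θ(t) ρ(y - x)` turn the equation into a weak derivative in `t` for each `y`.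
Continuity in `L²` makes the resulting formula hold at every time, including 0 and `T`. -/
theorem SolvesSchrodinger.spatialEvolution (hT : 0 < T) {V u : ℝ × EuclideanSpace ℝ (Fin n) → ℂ}
    (hu : SolvesSchrodinger T V u) (hu' : MemContLp T 2 u)
    (H : ∀ χ : EuclideanSpace ℝ (Fin n) → ℝ, Continuous χ → HasCompactSupport χ → ∀ y,
      HasCorrelation T u (fun z => (χ (y - z.2) : ℂ)))
    (H' : ∀ χ : EuclideanSpace ℝ (Fin n) → ℝ, Continuous χ → HasCompactSupport χ → ∀ y,
      HasCorrelation T (fun z => V z * u z) (fun z => (χ (y - z.2) : ℂ))) :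
    SpatialEvolution T Complex.I u (fun z => V z * u z) := by
  refine ⟨fun ρ h1 h2 y => (H _ (continuous_laplacian h1) h2.laplacian y).integral_mul_test.1,
    fun ρ h1 h2 y => (H' _ h1.continuous h2 y).integral_mul_test.1, fun ρ h1 h2 y => ?_⟩
  have A := (H _ h1.continuous h2 y).integral_mul_test
  have B := (H _ (continuous_laplacian h1) h2.laplacian y).integral_mul_test
  have C := (H' _ h1.continuous h2 y).integral_mul_test
  refine eq_add_integral_of_weak_deriv hT (hu'.continuousOn_spatialConv h1.continuous h2 y) ?_ ?_
  · rw [intervalIntegrable_iff_integrableOn_Ioo_of_le hT.le]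
    exact (B.1.sub C.1).const_mul Complex.I
  · intro θ hθ hθc hθs
    have hψc : HasCompactSupport fun x => ρ (y - x) := h2.comp_homeomorph (Homeomorph.subLeft y)
    have hzero : ∀ z ∉ tsupport θ ×ˢ tsupport (fun x => ρ (y - x)),
        (θ z.1 : ℂ) * (ρ (y - z.2) : ℂ) = 0 := by
      intro z hz
      rw [mem_prod, not_and_or] at hz
      rcases hz with hz | hz
      · simp [image_eq_zero_of_notMem_tsupport hz]
      · have := image_eq_zero_of_notMem_tsupport hz
        simp [this]
    have hφ : ContDiff ℝ (⊤ : ℕ∞)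
        (fun z : ℝ × EuclideanSpace ℝ (Fin n) => (θ z.1 : ℂ) * (ρ (y - z.2) : ℂ)) :=
      (Complex.ofRealCLM.contDiff.comp (hθ.comp contDiff_fst)).mul
        (Complex.ofRealCLM.contDiff.comp (h1.comp (contDiff_const.sub contDiff_snd)))
    have hφc : HasCompactSupport
        (fun z : ℝ × EuclideanSpace ℝ (Fin n) => (θ z.1 : ℂ) * (ρ (y - z.2) : ℂ)) :=
      HasCompactSupport.intro (hθc.isCompact.prod hψc.isCompact) hzero
    have hφs : tsupport (fun z : ℝ × EuclideanSpace ℝ (Fin n) => (θ z.1 : ℂ) * (ρ (y - z.2) : ℂ))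
        ⊆ slab n T := by
      refine (closure_minimal (fun z (hz : _ ≠ (0 : ℂ)) => by_contra fun hc => hz (hzero z hc))
        ((isClosed_tsupport θ).prod (isClosed_tsupport _))).trans ?_
      exact prod_mono hθs (subset_univ _)
    have hw := hu.weak _ hφ hφc hφs
    rw [volume_restrict_slab] at hw
    simp only [transposeSchrodinger_mul hθ h1] at hw
    obtain ⟨A1, A2, A3⟩ := A.2 (deriv θ) (hθ.continuous_deriv (by simp)) hθc.deriv
    obtain ⟨B1, B2, B3⟩ := B.2 θ hθ.continuous hθc
    obtain ⟨C1, C2, C3⟩ := C.2 θ hθ.continuous hθc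
    have e1 : ∫ z, u z * (-Complex.I * ((deriv θ z.1 : ℝ) : ℂ) * (ρ (y - z.2) : ℂ)
        + (θ z.1 : ℂ) * ((Laplacian.laplacian ρ (y - z.2) : ℝ) : ℂ)) ∂(slabMeasure n T) =
        -Complex.I * (∫ z, ((deriv θ z.1 : ℝ) : ℂ) * (u z * (ρ (y - z.2) : ℂ)) ∂(slabMeasure n T))
        + ∫ z, (θ z.1 : ℂ) * (u z * ((Laplacian.laplacian ρ (y - z.2) : ℝ) : ℂ))
          ∂(slabMeasure n T) := by
      rw [← integral_const_mul, ← integral_add (A1.const_mul _) B1]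
      congr 1; ext z; ring
    have e2 : ∫ z, V z * u z * ((θ z.1 : ℂ) * (ρ (y - z.2) : ℂ)) ∂(slabMeasure n T) =
        ∫ z, (θ z.1 : ℂ) * (V z * u z * (ρ (y - z.2) : ℂ)) ∂(slabMeasure n T) := by
      congr 1; ext z; ring
    rw [e1, e2, A3, B3, C3] at hw
    have e3 : ∫ s in Ioo 0 T, (θ s : ℂ) * (Complex.I *
        (spatialConv (Laplacian.laplacian ρ) u (s, y) - spatialConv ρ (fun z => V z * u z) (s, y)))
        = Complex.I * ((∫ s in Ioo 0 T, (θ s : ℂ) * spatialConv (Laplacian.laplacian ρ) u (s, y))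
          - ∫ s in Ioo 0 T, (θ s : ℂ) * spatialConv ρ (fun z => V z * u z) (s, y)) := by
      rw [← integral_sub B2 C2, ← integral_const_mul]
      congr 1; ext s; ring
    rw [e3]
    linear_combination Complex.I * hw + (∫ s in Ioo 0 T, ((deriv θ s : ℝ) : ℂ) *
      spatialConv ρ u (s, y)) * Complex.I_mul_I

/-! ### Green's formula, first mollified and then in the limit. -/

theorem integral_slab_snd (hT : 0 < T) (k : EuclideanSpace ℝ (Fin n) → ℂ) :
    ∫ z, k z.2 ∂(slabMeasure n T) = T * ∫ x, k x := by
  have := integral_prod_mul (μ := volume.restrict (Ioo 0 T))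
    (ν := (volume : Measure (EuclideanSpace ℝ (Fin n)))) (fun _ => (1 : ℂ)) k
  simpa [hT.le] using this

theorem integrable_of_integrable_slab_snd (hT : 0 < T) {k : EuclideanSpace ℝ (Fin n) → ℂ}
    (hk : Integrable (fun z => k z.2) (slabMeasure n T)) : Integrable k := by
  have h := hk.prod_right_ae
  have : (ae (volume.restrict (Ioo 0 T))).NeBot := by
    rw [ae_neBot, Ne, Measure.restrict_eq_zero]
    simpa using hT
  exact h.exists.choose_spec

/-- Mollifiers concentrating at the origin. -/
noncomputable def mollifier (n k : ℕ) : ContDiffBump (0 : EuclideanSpace ℝ (Fin n)) where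
  rIn := 1 / (2 * ((k : ℝ) + 1))
  rOut := 1 / ((k : ℝ) + 1)
  rIn_pos := by positivity
  rIn_lt_rOut := by
    apply one_div_lt_one_div_of_lt <;> linarith [(k.cast_nonneg : (0 : ℝ) ≤ k)]

theorem tendsto_mollifier_rOut (n : ℕ) : Tendsto (fun k => (mollifier n k).rOut) atTop (𝓝 0) :=
  tendsto_one_div_add_atTop_nhds_zero_nat

/-- The product rule at fixed `y`, integrated over `y`; the two Laplacian terms cancel because `ρ`
and `Δρ` are even. The boundary values are viewed as time-independent functions on the slab, so that
the same correlation lemmas apply to them; this is the origin of the factor `T`. -/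
theorem integral_mollified_product {u w F G : ℝ × EuclideanSpace ℝ (Fin n) → ℂ} (hT : 0 < T)
    (hu : SpatialEvolution T Complex.I u F) (hw : SpatialEvolution T (-Complex.I) w G)
    (H : HasCorrelation T u w) (HF : HasCorrelation T F w) (HG : HasCorrelation T u G)
    (H₀ : HasCorrelation T (fun z => u (0, z.2)) (fun z => w (0, z.2)))
    (H₁ : HasCorrelation T (fun z => u (T, z.2)) (fun z => w (T, z.2)))
    {ρ : EuclideanSpace ℝ (Fin n) → ℝ} (hρ : ContDiff ℝ (⊤ : ℕ∞) ρ) (hρc : HasCompactSupport ρ)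
    (hρe : ∀ x, ρ (-x) = ρ x) :
    (∫ z, spatialConv ρ (fun z => u (T, z.2)) z * spatialConv ρ (fun z => w (T, z.2)) z
        ∂(slabMeasure n T)) -
      ∫ z, spatialConv ρ (fun z => u (0, z.2)) z * spatialConv ρ (fun z => w (0, z.2)) z
        ∂(slabMeasure n T) =
    T * (-Complex.I * ((∫ z, spatialConv ρ F z * spatialConv ρ w z ∂(slabMeasure n T)) -
      ∫ z, spatialConv ρ u z * spatialConv ρ G z ∂(slabMeasure n T))) := by
  have hL := continuous_laplacian hρ
  have hLc := hρc.laplacian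
  have iρ : Integrable ρ := hρ.continuous.integrable_of_hasCompactSupport hρc
  have iL : Integrable (Laplacian.laplacian ρ) := hL.integrable_of_hasCompactSupport hLc
  have i₁ := H.integrable_spatialConv_mul iL iρ
  have i₂ := HF.integrable_spatialConv_mul iρ iρ
  have i₃ := H.integrable_spatialConv_mul iρ iL
  have i₄ := HG.integrable_spatialConv_mul iρ iρ
  have iR := (((i₁.sub i₂).sub i₃).add i₄).const_mul Complex.I
  have b₁ := H₁.integrable_spatialConv_mul iρ iρ
  have b₀ := H₀.integrable_spatialConv_mul iρ iρ
  have j₁ : Integrable fun y => spatialConv ρ u (T, y) * spatialConv ρ w (T, y) :=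
    integrable_of_integrable_slab_snd hT b₁
  have j₀ : Integrable fun y => spatialConv ρ u (0, y) * spatialConv ρ w (0, y) :=
    integrable_of_integrable_slab_snd hT b₀
  have e₁ := integral_slab_snd hT fun y => spatialConv ρ u (T, y) * spatialConv ρ w (T, y)
  have e₀ := integral_slab_snd hT fun y => spatialConv ρ u (0, y) * spatialConv ρ w (0, y)
  -- Convolution acts in space only, so it commutes definitionally with freezing the time.
  change ((∫ z, spatialConv ρ u (T, z.2) * spatialConv ρ w (T, z.2) ∂(slabMeasure n T)) -
      ∫ z, spatialConv ρ u (0, z.2) * spatialConv ρ w (0, z.2) ∂(slabMeasure n T)) = _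
  rw [e₁, e₀, ← mul_sub, ← integral_sub j₁ j₀]
  congr 1
  have key : ∀ y, spatialConv ρ u (T, y) * spatialConv ρ w (T, y)
      - spatialConv ρ u (0, y) * spatialConv ρ w (0, y) =
      ∫ t in Ioo 0 T, Complex.I *
        (spatialConv (Laplacian.laplacian ρ) u (t, y) * spatialConv ρ w (t, y)
          - spatialConv ρ F (t, y) * spatialConv ρ w (t, y)
          - spatialConv ρ u (t, y) * spatialConv (Laplacian.laplacian ρ) w (t, y)
          + spatialConv ρ u (t, y) * spatialConv ρ G (t, y)) := by
    intro y
    have d₁ : IntervalIntegrable (fun s => Complex.I *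
        (spatialConv (Laplacian.laplacian ρ) u (s, y) - spatialConv ρ F (s, y))) volume 0 T := by
      rw [intervalIntegrable_iff_integrableOn_Ioo_of_le hT.le]
      exact ((hu.integrableOn_laplacian ρ hρ hρc y).sub
        (hu.integrableOn_source ρ hρ hρc y)).const_mul _
    have d₂ : IntervalIntegrable (fun s => -Complex.I *
        (spatialConv (Laplacian.laplacian ρ) w (s, y) - spatialConv ρ G (s, y))) volume 0 T := by
      rw [intervalIntegrable_iff_integrableOn_Ioo_of_le hT.le]
      exact ((hw.integrableOn_laplacian ρ hρ hρc y).sub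
        (hw.integrableOn_source ρ hρ hρc y)).const_mul _
    have h := (integral_primitive_mul_primitive d₁ d₂
      (M := fun t => spatialConv ρ u (t, y)) (N := fun t => spatialConv ρ w (t, y))
      (by rw [uIcc_of_le hT.le]; exact hu.eq_add_integral ρ hρ hρc y)
      (by rw [uIcc_of_le hT.le]; exact hw.eq_add_integral ρ hρ hρc y)).2
    rw [← h, intervalIntegral.integral_of_le hT.le, integral_Ioc_eq_integral_Ioo]
    congr 1; ext t; ring
  simp_rw [key]
  have hsw := integral_prod_symm _ iR
  simp only [Pi.add_apply, Pi.sub_apply] at hsw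
  have s := integral_add' ((i₁.sub i₂).sub i₃) i₄
  rw [integral_sub' (i₁.sub i₂) i₃, integral_sub' i₁ i₂,
    H.integral_spatialConv_mul_comm iL iρ (laplacian_neg_of_even hρe) hρe] at s
  simp only [Pi.add_apply, Pi.sub_apply] at s
  rw [← hsw, integral_const_mul, s]
  ring

theorem integral_product_evolution {u w F G : ℝ × EuclideanSpace ℝ (Fin n) → ℂ} (hT : 0 < T)
    (hu : SpatialEvolution T Complex.I u F) (hw : SpatialEvolution T (-Complex.I) w G)
    (H : HasCorrelation T u w) (HF : HasCorrelation T F w) (HG : HasCorrelation T u G)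
    (H₀ : HasCorrelation T (fun z => u (0, z.2)) (fun z => w (0, z.2)))
    (H₁ : HasCorrelation T (fun z => u (T, z.2)) (fun z => w (T, z.2))) :
    Complex.I * ((∫ x, u (T, x) * w (T, x)) - ∫ x, u (0, x) * w (0, x)) =
      (∫ z, F z * w z ∂(slabMeasure n T)) - ∫ z, u z * G z ∂(slabMeasure n T) := by
  have hm := tendsto_mollifier_rOut n
  have l := (H₁.tendsto_integral_spatialConv_mul hm).sub (H₀.tendsto_integral_spatialConv_mul hm)
  have r := (((HF.tendsto_integral_spatialConv_mul hm).sub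
    (HG.tendsto_integral_spatialConv_mul hm)).const_mul (-Complex.I)).const_mul (T : ℂ)
  have e := tendsto_nhds_unique (l.congr fun k =>
    integral_mollified_product hT hu hw H HF HG H₀ H₁ (mollifier n k).contDiff_normed
      (mollifier n k).hasCompactSupport_normed (mollifier n k).normed_neg) r
  have e₁ := integral_slab_snd hT fun y => u (T, y) * w (T, y)
  have e₀ := integral_slab_snd hT fun y => u (0, y) * w (0, y)
  rw [e₁, e₀, ← mul_sub] at e
  have e' := mul_left_cancel₀ (by exact_mod_cast hT.ne') e
  rw [e', ← mul_assoc]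
  simp

/-! ### Physical solutions with potentials in the class `Y`. -/

theorem hasCorrelation_of_memMixedLp_two {u w : ℝ × EuclideanSpace ℝ (Fin n) → ℂ}
    (hu : MemMixedLp T ∞ 2 u) (hw : MemMixedLp T ∞ 2 w) : HasCorrelation T u w := by
  -- Since `(0, T)` is bounded, the constant 1 can serve as the third factor, in `L¹L^∞`.
  have h1 : MemMixedLp T 1 ∞ (fun _ : ℝ × EuclideanSpace ℝ (Fin n) => (1 : ℂ)) :=
    (memLp_top_const (1 : ℂ)).memMixedLp_snd (g := fun _ => 1) 1
  have := h1.hasCorrelation (s₁ := ∞) (s₂ := 2) (s₃ := 2) 2 hu hw (by simp) (by simp)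
  simpa using this

/-- The `V♯` part uses `L¹L^∞` with `L^∞L²` twice. The `V♭` part uses `L^aL^b` with `L^{q'}L^{r'}`
twice, where multiplication by `V♭` maps `L^{r'}` to the dual exponent `r`. -/
theorem MemPotentialClass.hasCorrelation {a b q q' r r' : ℝ≥0∞} (hb : 1 ≤ b)
    (hq : RelatedExponents a q q') (hr : RelatedExponents b r r')
    {V u w : ℝ × EuclideanSpace ℝ (Fin n) → ℂ} (hV : MemPotentialClass T a b V)
    (hu : MemMixedLp T ∞ 2 u) (hu' : MemMixedLp T q' r' u)
    (hw : MemMixedLp T ∞ 2 w) (hw' : MemMixedLp T q' r' w) :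
    HasCorrelation T (fun z => V z * u z) w := by
  obtain ⟨V₁, V₂, h₁, h₂, h₃, hV⟩ := hV
  have hV₂ : MemMixedLp T a b V₂ := by
    rcases eq_or_ne a ∞ with rfl | ha
    · exact (h₃ rfl).memMixedLp hb
    · exact h₂ ha
  have H₁ := h₁.hasCorrelation (s₁ := ∞) (s₂ := 2) (s₃ := 2) 2 hu hw (by simp) (by simp)
  have hq₁ := hq.conjugate
  have hr₁ := hr.conjugate
  rw [hq.related] at hq₁
  have hr₂ := hr.related
  simp only [one_div] at hq₁ hr₁ hr₂
  have : ENNReal.HolderTriple b r' r := ⟨by rw [hr₂, add_comm]⟩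
  have : ENNReal.HolderTriple r r' 1 := ⟨by rw [hr₁, inv_one]⟩
  -- If `r` were infinite, `1/r = 1/r' + 1/b` would force `1/r' = 0`, against conjugacy.
  have hrt : r ≠ ∞ := by
    rintro rfl
    rw [ENNReal.inv_top] at hr₁ hr₂
    have h0 : r'⁻¹ = 0 := by
      have := hr₂.symm
      rw [add_eq_zero] at this
      exact this.1
    simp [h0] at hr₁
  have H₂ := hV₂.hasCorrelation (s₁ := b) (s₂ := r') (s₃ := r') r hu' hw'
    (by rw [add_comm a⁻¹]; exact hq₁) hrt
  refine (H₁.add_left H₂).congr_left ?_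
  rw [volume_restrict_slab] at hV
  filter_upwards [hV] with z hz
  rw [hz]; ring

theorem IsPhysicalSolution.spatialEvolution {a b q q' r r' : ℝ≥0∞} (hT : 0 < T) (hb : 1 ≤ b)
    (hq : RelatedExponents a q q') (hr : RelatedExponents b r r')
    {V u : ℝ × EuclideanSpace ℝ (Fin n) → ℂ} (hV : MemPotentialClass T a b V) {τ : ℝ}
    {h : Lp ℂ 2 (volume : Measure (EuclideanSpace ℝ (Fin n)))}
    (hu : IsPhysicalSolution T q' r' V τ h u) :
    SpatialEvolution T Complex.I u (fun z => V z * u z) := by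
  have hu₂ := hu.memXStar.memContLp.memMixedLp one_le_two
  refine hu.solves.spatialEvolution hT hu.memXStar.memContLp (fun χ hχ hχc y => ?_)
    fun χ hχ hχc y => ?_
  · exact hasCorrelation_of_memMixedLp_two hu₂ ((memLp_test hχ hχc y 2).memMixedLp_snd _)
  · exact hV.hasCorrelation hb hq hr hu₂ hu.memXStar.memMixedLp
      ((memLp_test hχ hχc y 2).memMixedLp_snd _) ((memLp_test hχ hχc y r').memMixedLp_snd _)

theorem MemPotentialClass.conj {a b : ℝ≥0∞} {V : ℝ × EuclideanSpace ℝ (Fin n) → ℂ}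
    (hV : MemPotentialClass T a b V) : MemPotentialClass T a b (fun z => conj (V z)) := by
  obtain ⟨V₁, V₂, h₁, h₂, h₃, hV⟩ := hV
  refine ⟨_, _, h₁.conj, fun ha => (h₂ ha).conj, fun ha => (h₃ ha).conj, ?_⟩
  filter_upwards [hV] with z hz
  rw [hz, map_add]

/-- The Green formula for a solution of the initial-value problem with potential `V₁` and a solution
of the final-value problem with potential `conj V₂`. -/
theorem IsPhysicalSolution.integral_product {a b q q' r r' : ℝ≥0∞} (hT : 0 < T) (hb : 1 ≤ b)
    (hq : RelatedExponents a q q') (hr : RelatedExponents b r r')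
    {V₁ V₂ u v : ℝ × EuclideanSpace ℝ (Fin n) → ℂ} (hV₁ : MemPotentialClass T a b V₁)
    (hV₂ : MemPotentialClass T a b V₂) {τ₁ τ₂ : ℝ}
    {f g : Lp ℂ 2 (volume : Measure (EuclideanSpace ℝ (Fin n)))}
    (hu : IsPhysicalSolution T q' r' V₁ τ₁ f u)
    (hv : IsPhysicalSolution T q' r' (fun z => conj (V₂ z)) τ₂ g v) :
    Integrable (fun z => (V₁ z - V₂ z) * u z * conj (v z)) (slabMeasure n T) ∧
    Complex.I * ((∫ x, u (T, x) * conj (v (T, x))) - ∫ x, u (0, x) * conj (v (0, x))) =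
      ∫ z, (V₁ z - V₂ z) * u z * conj (v z) ∂(slabMeasure n T) := by
  have hw := hv.memXStar.conj
  have hu₂ := hu.memXStar.memContLp.memMixedLp one_le_two
  have hw₂ := hw.memContLp.memMixedLp one_le_two
  have evu := hu.spatialEvolution hT hb hq hr hV₁
  have evw := (hv.spatialEvolution hT hb hq hr hV₂.conj).conj
  simp only [Complex.conj_I, map_mul, Complex.conj_conj] at evw
  have H := hasCorrelation_of_memMixedLp_two hu₂ hw₂
  have HF := hV₁.hasCorrelation hb hq hr hu₂ hu.memXStar.memMixedLp hw₂ hw.memMixedLp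
  -- Here the potential multiplies `conj v`, so the Hölder bound is taken with the factors exchanged
  -- and then transposed.
  have HG := (hV₂.hasCorrelation hb hq hr hw₂ hw.memMixedLp hu₂ hu.memXStar.memMixedLp).symm
  have slice : ∀ t ∈ Icc 0 T,
      HasCorrelation T (fun z => u (t, z.2)) (fun z => conj (v (t, z.2))) := fun t ht =>
    hasCorrelation_of_memMixedLp_two ((hu.memXStar.memContLp.memLp t ht).memMixedLp_snd ∞)
      ((hw.memContLp.memLp t ht).memMixedLp_snd ∞)
  have main := integral_product_evolution hT evu evw H HF HG (slice 0 ⟨le_rfl, hT.le⟩)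
    (slice T ⟨hT.le, le_rfl⟩)
  have e : (fun z => (V₁ z - V₂ z) * u z * conj (v z)) =
      fun z => V₁ z * u z * conj (v z) - u z * (V₂ z * conj (v z)) := by
    ext z; ring
  rw [e]
  refine ⟨HF.integrable_mul.sub HG.integrable_mul, ?_⟩
  rw [main, integral_sub HF.integrable_mul HG.integrable_mul]

end

theorem mainTheorem7 (n : ℕ) (hn : 1 ≤ n) (T : ℝ) (hT : 0 < T)
    (a b q r q' r' : ℝ≥0∞) (hab : PotentialExponents n a b)
    (hq : RelatedExponents a q q') (hr : RelatedExponents b r r')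
    (V₁ V₂ : ℝ × EuclideanSpace ℝ (Fin n) → ℂ)
    (hV₁ : MemPotentialClass T a b V₁) (hV₂ : MemPotentialClass T a b V₂)
    (f g : Lp ℂ 2 (volume : Measure (EuclideanSpace ℝ (Fin n))))
    (UTf₁ UTf₂ : Lp ℂ 2 (volume : Measure (EuclideanSpace ℝ (Fin n))))
    (u₁ u₂ v₂ : ℝ × EuclideanSpace ℝ (Fin n) → ℂ)
    (hu₁ : IsPhysicalSolution T q' r' V₁ 0 f u₁)
    (hu₂ : IsPhysicalSolution T q' r' V₂ 0 f u₂)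
    (hUTf₁ : (fun x => u₁ (T, x)) =ᵐ[volume] UTf₁)
    (hUTf₂ : (fun x => u₂ (T, x)) =ᵐ[volume] UTf₂)
    (hv₂ : IsPhysicalSolution T q' r' (fun z => conj (V₂ z)) T g v₂) :
    IntegrableOn (fun z => (V₁ z - V₂ z) * u₁ z * conj (v₂ z)) (slab n T) volume ∧
    Complex.I * ∫ x, (UTf₁ - UTf₂ : Lp ℂ 2 (volume : Measure (EuclideanSpace ℝ (Fin n)))) x
        * conj (g x)
      = ∫ z in slab n T, (V₁ z - V₂ z) * u₁ z * conj (v₂ z) := by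
  rw [IntegrableOn, volume_restrict_slab]
  have hb := hab.one_le_right
  obtain ⟨I₁, E₁⟩ := hu₁.integral_product hT hb hq hr hV₁ hV₂ hv₂
  -- With `V₂` in both places the right side vanishes: the pairing of `u₂` with `v₂` is conserved
  -- between times 0 and `T`.
  obtain ⟨-, E₂⟩ := hu₂.integral_product hT hb hq hr hV₂ hV₂ hv₂
  refine ⟨I₁, ?_⟩
  simp only [sub_self, zero_mul, integral_zero] at E₂
  have hinit : ∫ x, u₁ (0, x) * conj (v₂ (0, x)) = ∫ x, u₂ (0, x) * conj (v₂ (0, x)) := by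
    refine integral_congr_ae ?_
    filter_upwards [hu₁.value, hu₂.value] with x h₁ h₂
    rw [h₁, h₂]
  have hfin : ∀ (U : Lp ℂ 2 (volume : Measure (EuclideanSpace ℝ (Fin n))))
      (u : ℝ × EuclideanSpace ℝ (Fin n) → ℂ), (fun x => u (T, x)) =ᵐ[volume] U →
      ∫ x, u (T, x) * conj (v₂ (T, x)) = ∫ x, U x * conj (g x) := by
    intro U u hU
    refine integral_congr_ae ?_
    filter_upwards [hU, hv₂.value] with x h₁ h₂
    rw [h₁, h₂]
  have hint : ∀ U : Lp ℂ 2 (volume : Measure (EuclideanSpace ℝ (Fin n))),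
      Integrable fun x => U x * conj (g x) := fun U =>
    memLp_one_iff_integrable.1 (MemLp.mul' (Lp.memLp g).star (Lp.memLp U))
  have hsub : ∫ x, (UTf₁ - UTf₂ : Lp ℂ 2 (volume : Measure (EuclideanSpace ℝ (Fin n)))) x
      * conj (g x) = (∫ x, UTf₁ x * conj (g x)) - ∫ x, UTf₂ x * conj (g x) := by
    rw [← integral_sub (hint _) (hint _)]
    refine integral_congr_ae ?_
    filter_upwards [Lp.coeFn_sub UTf₁ UTf₂] with x hx
    rw [hx, Pi.sub_apply, sub_mul]
  rw [hfin _ _ hUTf₁, hinit] at E₁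
  rw [hfin _ _ hUTf₂] at E₂
  rw [hsub, ← E₁]
  linear_combination -E₂
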